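/- **Conventions.** An *invertible automaton* over a finite alphabet $X$ consists of a finite set $S$ of states, a transition map $t:S\times X\to S$ and an output map $o:S\times X\to X$ such that $o(s,\cdot)$ is a permutation of $X$ for every $s\in S$. Put $s|_{\varepsilon}=s$ and $s|_{xv}=t(s,x)|_v$. Each state $s$ acts on the set $X^*$ of all words by $s(\varepsilon)=\varepsilon$, $s(xv)=o(s,x)\,t(s,x)(v)$; this is a permutation of $X^*$, and the *automaton group* is the subgroup of $\mathrm{Sym}(X^*)$ generated by the permutations defined by the states. The automaton is *bounded* if there is a constant $C$ such that, for all $s\in S$ and $n\in\mathbb N$, there are at most $C$ words $v\in X^n$ for which $s|_v$ does not act as the identity. A word $w\in S^*$ represents the transformation obtained by applying its letters from left to right. Its section at $x\in X$ is defined by $\varepsilon|_x=\varepsilon$ and $(sw)|_x=t(s,x)\,(w|_{o(s,x)})$, and $l_S(w)$ is the length of a shortest word over $S$ that represents the same transformation as $w$. If the set of transformations defined by the states is closed under inversion, the automaton is *strongly contracting* if $\sum_{x\in X} l_S(w|_x)<|w|$ for all sufficiently long words $w\in S^*$. A group is a *strongly contracting automaton group* if it is isomorphic to the automaton group of some strongly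 contracting automaton. For a finite generating set $T$ of a group $G$ that is closed under inversion, the word problem $\mathrm{WP}(G,T)$ is the language of all words over $T$ that represent the identity of $G$. $\mathrm{DTIME}_*(t(n))$ is the class of languages decided in time $O(t(n))$ by a deterministic multi-tape Turing machine. **Theorem.** (1) Let $G$ be (isomorphic to) the group generated by a bounded invertible automaton. Then $\mathrm{WP}(G,T)\in\mathrm{DTIME}_*(n\log n)$ for every finite generating set $T$ of $G$ that is closed under inversion. (2) Let $G$ be a strongly contracting automaton group. Then $\mathrm{WP}(G,T)\in\mathrm{DTIME}_*(n)$ for every finite generating set $T$ of $G$ that is closed under inversion. -/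

import Mathlib

open Filter Asymptotics

/-! ### Deterministic multi-tape Turing machines -/

/-- A deterministic multi-tape Turing machine with input alphabet `σ`.
There are finitely many two-way infinite tapes, with one head each; in one step the machine reads
the symbols under all the heads and, depending on its state and on these symbols, changes the state,
overwrites the scanned symbols, and moves each head left, right or not at all (`none`).
The machine halts when the transition function has no value. -/
structure MultiTapeTM (σ : Type*) where
  /-- the index set of the tapes -/
  K : Type
  /-- the tape alphabet -/
  Γ : Type
  /-- the set of states -/
  Q : Type
  finiteK : Finite K
  finiteΓ : Finite Γ
  finiteQ : Finite Q
  /-- the tape that holds the input -/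
  inputTape : K
  /-- the blank symbol -/
  blank : Γ
  /-- the input symbols as symbols of the tape alphabet -/
  symbol : σ ↪ Γ
  symbol_ne_blank : ∀ a, symbol a ≠ blank
  /-- the initial state -/
  start : Q
  /-- the accepting states: an input is accepted if the machine halts in such a state -/
  accept : Set Q
  /-- the transition function -/
  δ : Q → (K → Γ) → Option (Q × (K → Γ × Option Turing.Dir))

namespace MultiTapeTM

variable {σ : Type*} (M : MultiTapeTM σ)

instance : Inhabited M.Γ := ⟨M.blank⟩

/-- A configuration: the state, and the contents of the tapes with the positions of the heads. -/
structure Cfg where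
  state : M.Q
  tape : M.K → Turing.Tape M.Γ

/-- The initial configuration: the input tape holds `w`, its head is on the first letter of `w`,
and everything else is blank. -/
noncomputable def initCfg (w : List σ) : M.Cfg where
  state := M.start
  tape k := open Classical in
    if k = M.inputTape then Turing.Tape.mk₁ (w.map M.symbol) else Turing.Tape.mk₁ []

variable {M}

/-- The transition that applies in a configuration, if there is one. -/
def Cfg.transition (c : M.Cfg) : Option (M.Q × (M.K → M.Γ × Option Turing.Dir)) :=
  M.δ c.state fun k => (c.tape k).head

/-- A configuration is halting if no transition applies. -/
def Cfg.Halted (c : M.Cfg) : Prop := c.transition = none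

/-- Write the symbol `a.1` and then move the head according to `a.2`. -/
def updateTape (T : Turing.Tape M.Γ) (a : M.Γ × Option Turing.Dir) : Turing.Tape M.Γ :=
  match a.2 with
  | none => T.write a.1
  | some d => (T.write a.1).move d

/-- One step of the computation; a halting configuration does not change. -/
def Cfg.step (c : M.Cfg) : M.Cfg :=
  match c.transition with
  | none => c
  | some (q, a) => ⟨q, fun k => updateTape (c.tape k) (a k)⟩

variable (M)

/-- The configuration that the machine is in after `n` steps on the input `w` (or in which it has
halted before). -/
noncomputable def cfgAfter (w : List σ) (n : ℕ) : M.Cfg := Cfg.step^[n] (M.initCfg w)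

/-- `M` decides the language `L` in time `f`: on every input `w` it halts within `f |w|` steps, and
it accepts exactly the words of `L`. -/
def DecidesInTime (L : Language σ) (f : ℕ → ℕ) : Prop :=
  ∀ w : List σ, (M.cfgAfter w (f w.length)).Halted ∧
    ((M.cfgAfter w (f w.length)).state ∈ M.accept ↔ w ∈ L)

end MultiTapeTM

/-- The languages decided by a deterministic multi-tape Turing machine in time `O(t(n))`. -/
def InMultiTapeDTIME {σ : Type*} (L : Language σ) (t : ℕ → ℝ) : Prop :=
  ∃ (M : MultiTapeTM σ) (f : ℕ → ℕ), M.DecidesInTime L f ∧ (fun n => (f n : ℝ)) =O[atTop] t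

/-! ### The word problem -/

/-- The word problem of `G` with respect to `S`: the words over `S` that represent the identity. -/
def wordProblem {G : Type*} [Group G] (S : Finset G) : Language S :=
  {w : List S | (w.map Subtype.val).prod = 1}

/-- `G` is finitely generated, and its word problem is decided in time `O(t(n))` by a multi-tape
Turing machine, with respect to every finite generating set that is closed under inversion. -/
def WordProblemInMultiTapeDTIME (G : Type*) [Group G] (t : ℕ → ℝ) : Prop :=
  Group.FG G ∧ ∀ S : Finset G, (∀ a ∈ S, a⁻¹ ∈ S) → Subgroup.closure (S : Set G) = ⊤ →
    InMultiTapeDTIME (wordProblem S) t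

/-! ### Automaton groups -/

/-- An invertible automaton (Mealy machine) with set of states `S` over the alphabet `X`: for each
state, the output map is a permutation of `X`. -/
structure InvertibleAutomaton (S X : Type*) where
  /-- the transition map -/
  t : S → X → S
  /-- the output map -/
  o : S → Equiv.Perm X

namespace InvertibleAutomaton

variable {S X : Type*} (A : InvertibleAutomaton S X)

/-- The output of the automaton on a word, when it is started in the state `s`. -/
def out : S → List X → List X
  | _, [] => []
  | s, x :: v => A.o s x :: out (A.t s x) v

/-- The inverse of `out`. -/
def outInv : S → List X → List X
  | _, [] => []
  | s, y :: v => (A.o s).symm y :: outInv (A.t s ((A.o s).symm y)) v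

theorem outInv_out (s : S) (v : List X) : A.outInv s (A.out s v) = v := by
  induction v generalizing s with
  | nil => rfl
  | cons x v ih => simp [out, outInv, ih]

theorem out_outInv (s : S) (v : List X) : A.out s (A.outInv s v) = v := by
  induction v generalizing s with
  | nil => rfl
  | cons x v ih => simp [out, outInv, ih]

/-- The transformation of the set of all words defined by a state. -/
def perm (s : S) : Equiv.Perm (List X) where
  toFun := A.out s
  invFun := A.outInv s
  left_inv := A.outInv_out s
  right_inv := A.out_outInv s

/-- The automaton group: the group of permutations of the set of all words that is generated by
the transformations defined by the states. -/
def group : Subgroup (Equiv.Perm (List X)) := Subgroup.closure (Set.range A.perm)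

/-- The section `s|_v` of a state at a word: the state that the automaton reaches from `s` after
reading `v`. -/
def stateSection (s : S) (v : List X) : S := v.foldl A.t s

/-- A state is trivial if it defines the identity transformation. -/
def IsTrivialState (s : S) : Prop := A.perm s = 1

/-- The automaton is bounded: there is a constant `C` such that, for every state `s` and every `n`,
at most `C` words `v` of length `n` have a nontrivial section `s|_v`. (Over a finite alphabet the
sets counted here are finite.) -/
def IsBounded : Prop :=
  ∃ C : ℕ, ∀ (s : S) (n : ℕ),
    {v : List X | v.length = n ∧ ¬ A.IsTrivialState (A.stateSection s v)}.ncard ≤ C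

/-- The transformation represented by a word over the states; the words act from the right, that
is, the first letter acts first. -/
def wordPerm : List S → Equiv.Perm (List X)
  | [] => Equiv.refl _
  | s :: w => (A.perm s).trans (wordPerm w)

/-- The section `w|_x` of a word over the states at a letter `x`. -/
def wordSection : List S → X → List S
  | [], _ => []
  | s :: w, x => A.t s x :: wordSection w (A.o s x)

/-- The word length `l_S(w)` of the group element represented by `w`: the length of the shortest
word over the states that represents the same element. -/
noncomputable def len (w : List S) : ℕ :=
  sInf {n : ℕ | ∃ u : List S, u.length = n ∧ A.wordPerm u = A.wordPerm w}

/-- The inverse of the transformation defined by a state is defined by a state. -/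
def IsClosedUnderInversion : Prop := ∀ s, ∃ s', A.perm s' = (A.perm s)⁻¹

/-- For all sufficiently long words `w` over the states, `∑ l_S(w|_x) < |w|`, where the sum is over
all the letters `x` of the alphabet. -/
def IsStronglyContracting [Fintype X] : Prop :=
  ∃ N : ℕ, ∀ w : List S, N ≤ w.length → ∑ x : X, A.len (A.wordSection w x) < w.length

end InvertibleAutomaton

/-- `G` is (isomorphic to) a group generated by a bounded automaton. -/
def IsBoundedAutomatonGroup (G : Type*) [Group G] : Prop :=
  ∃ (S X : Type) (_ : Fintype S) (_ : Fintype X) (A : InvertibleAutomaton S X),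
    A.IsBounded ∧ Nonempty (G ≃* A.group)

/-- `G` is (isomorphic to) an automaton group that is strongly contracting with respect to some
generating automaton whose set of states is closed under inversion. -/
def IsStronglyContractingAutomatonGroup (G : Type*) [Group G] : Prop :=
  ∃ (S X : Type) (_ : Fintype S) (_ : Fintype X) (A : InvertibleAutomaton S X),
    A.IsClosedUnderInversion ∧ A.IsStronglyContracting ∧ Nonempty (G ≃* A.group)

/-! Both parts use the same recursion: a word over the states acts trivially if and only if it fixes
every letter of the alphabet and all its first-level sections act trivially
(`InvertibleAutomaton.wordPerm_eq_one_iff`). Suppose that a finite-state transducer reads a word,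
tests a condition on its state at the end, and writes for every letter a word that is trivial
exactly when the section is, as far as its own test has not settled this. Iterating it over the tree
of sections solves the word problem. A multi-tape machine does this depth first, with its main tape
as a stack, in time proportional to the total length of all the words that arise
(`Transducer.exists_decidesInTime`). It remains to bound this total length by a potential `T`.
Strongly contracting case: the word is cut into blocks of bounded length that are long enough for
the contraction, and the sections of each block are replaced by geodesics. Every block loses a
letter, so the children of `w` have total length at most `(1 - 1/K)|w|`. The geometric series gives
linear time. Bounded case: on a suitable level `M`, every section of a state is either rooted or
directed with respect to the alphabet of words of length `M` (`IsBounded.exists_level`), so every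
group element has sections that are words in such automorphisms (`IsBounded.exists_represents`). A
directed automorphism has exactly one directed section, hence the numbers of directed letters in the
sections of a word add up to the number in the word (`sum_numHits`), and every level of the tree
costs linear time. For logarithmic depth, adjacent directed letters are merged when their special
letters match. Two consecutive syllables can both survive in the same section only if they are
linked, so a section keeps about half of the syllables and links together (`two_mul_numHits_le`).
Since merging has been done, a link in a normal form needs a nontrivial rooted factor, which comes
from a further syllable of the parent; thus syllables and links of a section together are at most as
many as the syllables of the parent (`length_sectionForm_add_numLinks_le`). The length is therefore
roughly halved every two levels, and the total is `O(n log n)`. -/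

/-! ### Runs of Turing machines on tapes that are used as stacks -/

namespace MultiTapeTM

variable {σ : Type*} {M : MultiTapeTM σ}

theorem updateTape_stay (L : List M.Γ) (T : Turing.Tape M.Γ) (hT : T = Turing.Tape.mk₁ L) :
    updateTape T (T.head, none) = Turing.Tape.mk₁ L := by
  subst hT
  exact Turing.Tape.write_self _

/-- Stacks grow to the left. If the scanned cell is blank, this is a push, after which the head is
on a blank cell again; `updateTape_right` is the matching pop. -/
theorem updateTape_left (L : List M.Γ) (a : M.Γ) :
    updateTape (Turing.Tape.mk₁ L) (a, some Turing.Dir.left) =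
      Turing.Tape.mk₁ (M.blank :: a :: L.tail) := by
  simp only [updateTape, Turing.Tape.mk₁, Turing.Tape.mk₂, Turing.Tape.write_mk',
    Turing.Tape.move_left_mk']
  rfl

theorem mk_singleton_blank :
    Turing.ListBlank.mk [M.blank] = Turing.ListBlank.mk ([] : List M.Γ) :=
  (Quotient.sound' (Or.inl ⟨1, rfl⟩)).symm

/-- Trailing blanks are invisible on a tape; so an empty auxiliary tape can be written as
`[.blank]`, in the same form `.blank :: _` as a full one. -/
theorem tape_singleton_blank :
    Turing.Tape.mk₁ [M.blank] = Turing.Tape.mk₁ ([] : List M.Γ) := by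
  simp only [Turing.Tape.mk₁, Turing.Tape.mk₂, mk_singleton_blank]

theorem updateTape_right (L : List M.Γ) :
    updateTape (Turing.Tape.mk₁ L) (M.blank, some Turing.Dir.right) =
      Turing.Tape.mk₁ L.tail := by
  simp only [updateTape, Turing.Tape.mk₁, Turing.Tape.mk₂, Turing.Tape.write_mk',
    Turing.Tape.move_right_mk', Turing.ListBlank.cons_mk, Turing.ListBlank.tail_mk,
    Turing.ListBlank.head_mk, List.headI_cons, List.tail_cons, mk_singleton_blank]

/-- `c` leads to `c'` in at most `t` steps. -/
def LeadsTo (c : M.Cfg) (t : ℕ) (c' : M.Cfg) : Prop := ∃ n ≤ t, Cfg.step^[n] c = c'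

/-- Within `t` steps, `c` leads to `c'` if `p` holds, and to a rejecting halting configuration
otherwise. -/
def TestsTo (c : M.Cfg) (t : ℕ) (p : Prop) (c' : M.Cfg) : Prop :=
  (p → LeadsTo c t c') ∧ (¬ p → ∃ d : M.Cfg, LeadsTo c t d ∧ d.Halted ∧ d.state ∉ M.accept)

theorem LeadsTo.refl (c : M.Cfg) : LeadsTo c 0 c := ⟨0, le_rfl, rfl⟩

theorem LeadsTo.of_step {c c' : M.Cfg} (h : c.step = c') : LeadsTo c 1 c' := ⟨1, le_rfl, h⟩

theorem LeadsTo.trans {c c' c'' : M.Cfg} {s t : ℕ} (h : LeadsTo c s c') (h' : LeadsTo c' t c'') :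
    LeadsTo c (s + t) c'' := by
  obtain ⟨m, hm, rfl⟩ := h
  obtain ⟨n, hn, rfl⟩ := h'
  exact ⟨n + m, by omega, Function.iterate_add_apply _ _ _ _⟩

theorem LeadsTo.mono {c c' : M.Cfg} {s t : ℕ} (h : LeadsTo c s c') (hst : s ≤ t) :
    LeadsTo c t c' := by
  obtain ⟨m, hm, h⟩ := h
  exact ⟨m, hm.trans hst, h⟩

theorem LeadsTo.testsTo {c c' : M.Cfg} {t : ℕ} {p : Prop} (h : LeadsTo c t c') (hp : p) :
    TestsTo c t p c' := ⟨fun _ => h, fun h' => absurd hp h'⟩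

/-- A rejecting configuration is final, so the first failing test decides the outcome of a chain of
tests. -/
theorem TestsTo.trans {c c' c'' : M.Cfg} {s t : ℕ} {p q : Prop} (h : TestsTo c s p c')
    (h' : TestsTo c' t q c'') : TestsTo c (s + t) (p ∧ q) c'' := by
  refine ⟨fun hpq => (h.1 hpq.1).trans (h'.1 hpq.2), fun hpq => ?_⟩
  by_cases hp : p
  · obtain ⟨d, hd, hd'⟩ := h'.2 fun hq => hpq ⟨hp, hq⟩
    exact ⟨d, (h.1 hp).trans hd, hd'⟩
  · obtain ⟨d, hd, hd'⟩ := h.2 hp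
    exact ⟨d, hd.mono (Nat.le_add_right _ _), hd'⟩

theorem TestsTo.mono {c c' : M.Cfg} {s t : ℕ} {p q : Prop} (h : TestsTo c s p c') (hst : s ≤ t)
    (hpq : p ↔ q) : TestsTo c t q c' := by
  refine ⟨fun hq => (h.1 (hpq.2 hq)).mono hst, fun hq => ?_⟩
  obtain ⟨d, hd, hd'⟩ := h.2 fun hp => hq (hpq.1 hp)
  exact ⟨d, hd.mono hst, hd'⟩

theorem Cfg.Halted.iterate_step {c : M.Cfg} (h : c.Halted) (n : ℕ) : Cfg.step^[n] c = c := by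
  apply Function.iterate_fixed
  rw [Cfg.Halted] at h
  simp [Cfg.step, h]

/-- Halting configurations are fixed by `Cfg.step`; this turns "at most `t` steps" into the exact
number of steps in `DecidesInTime`. -/
theorem LeadsTo.iterate_eq {c d : M.Cfg} {t : ℕ} (h : LeadsTo c t d) (hd : d.Halted) :
    Cfg.step^[t] c = d := by
  obtain ⟨n, hn, rfl⟩ := h
  obtain ⟨m, rfl⟩ := Nat.exists_eq_add_of_le hn
  rw [Nat.add_comm, Function.iterate_add_apply, hd.iterate_step]

end MultiTapeTM

/-! ### Transducers -/

/-- A finite-state transducer that reads a word over `α` and writes words over `β` on `k` output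
tapes; it accepts or rejects at the end of the input. -/
structure Transducer (α β : Type) (k : ℕ) where
  /-- the set of states -/
  Q : Type
  finiteQ : Finite Q
  /-- the initial state -/
  init : Q
  /-- the transition function -/
  next : Q → α → Q
  /-- the words written in a transition -/
  write : Q → α → Fin k → List β
  /-- the accepting states -/
  accept : Q → Prop
  /-- the words written at the end of the input -/
  last : Q → Fin k → List β

namespace Transducer

variable {α β : Type} {k : ℕ} (R : Transducer α β k)

/-- The state reached from `q` by reading a word. -/
def run : R.Q → List α → R.Q
  | q, [] => q
  | q, a :: w => run (R.next q a) w

/-- What is written on the output tapes when a word is read, starting in `q`. -/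
def output : R.Q → List α → Fin k → List β
  | q, [], i => R.last q i
  | q, a :: w, i => R.write q a i ++ output (R.next q a) w i

/-- The words written on the output tapes, starting in the initial state. -/
def child (w : List α) (i : Fin k) : List β := R.output R.init w i

/-- The input word is accepted. -/
def Accepts (w : List α) : Prop := R.accept (R.run R.init w)

/-- Because of this bound, what one transition writes on a tape fits into a single tape symbol, and
one transition costs one step of the machine. -/
theorem exists_bound [Finite α] : ∃ B : ℕ, (∀ q a i, (R.write q a i).length ≤ B) ∧
    ∀ q i, (R.last q i).length ≤ B := by
  have := R.finiteQ
  obtain ⟨B, hB⟩ := (Set.finite_range fun p : R.Q × α × Fin k =>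
    (R.write p.1 p.2.1 p.2.2).length).bddAbove
  obtain ⟨C, hC⟩ := (Set.finite_range fun p : R.Q × Fin k => (R.last p.1 p.2).length).bddAbove
  exact ⟨max B C, fun q a i => le_max_of_le_left (hB ⟨(q, a, i), rfl⟩),
    fun q i => le_max_of_le_right (hC ⟨(q, i), rfl⟩)⟩

/-- The lists of length at most `B`. -/
abbrev Block (β : Type) (B : ℕ) : Type := {l : List β // l.length ≤ B}

instance [Finite β] (B : ℕ) : Finite (Block β B) := List.finite_length_le β B

/-- The first `B` letters of a word, as a block. -/
def Block.cut (B : ℕ) (l : List β) : Block β B := ⟨l.take B, by simp⟩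

theorem Block.cut_val {B : ℕ} {l : List β} (h : l.length ≤ B) : (Block.cut B l).1 = l :=
  List.take_of_length_le h

/-- The tape alphabet of the machine that iterates a transducer. -/
inductive Sym (α β : Type) (B : ℕ)
  | blank
  | sep
  | letter (a : α)
  | cell (l : Block β B)

instance [Finite α] [Finite β] (B : ℕ) : Finite (Sym α β B) :=
  Finite.of_surjective (fun x : Option (Option (α ⊕ Block β B)) => match x with
    | none => Sym.blank
    | some none => Sym.sep
    | some (some (Sum.inl a)) => Sym.letter a
    | some (some (Sum.inr l)) => Sym.cell l) (by
    rintro (_ | _ | a | l)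
    exacts [⟨none, rfl⟩, ⟨some none, rfl⟩, ⟨some (some (Sum.inl a)), rfl⟩,
      ⟨some (some (Sum.inr l)), rfl⟩])

/-- The states of the machine that iterates a transducer. -/
inductive State (Q β : Type) (k B : ℕ)
  | idle
  | read (q : Q)
  | unload (j : Fin (k + 1))
  | move (i : Fin k) (l : Block β B)

instance (Q : Type) [Finite Q] [Finite β] (B : ℕ) : Finite (State Q β k B) :=
  Finite.of_surjective (fun x : Option (Q ⊕ Fin (k + 1) ⊕ Fin k × Block β B) => match x with
    | none => State.idle
    | some (Sum.inl q) => State.read q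
    | some (Sum.inr (Sum.inl j)) => State.unload j
    | some (Sum.inr (Sum.inr p)) => State.move p.1 p.2) (by
    rintro (_ | q | j | ⟨i, l⟩)
    exacts [⟨none, rfl⟩, ⟨some (Sum.inl q), rfl⟩, ⟨some (Sum.inr (Sum.inl j)), rfl⟩,
      ⟨some (Sum.inr (Sum.inr (i, l))), rfl⟩])

variable {σ : Type} (R : Transducer (σ ⊕ β) β k) (B : ℕ)

/-- What is done to a tape that is not used in a step. -/
abbrev stay {Γ : Type} (a : Γ) : Γ × Option Turing.Dir := (a, none)

/-- The transition function of the machine that iterates the transducer `R`. The main tape, with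
index `none`, is a stack of words over `σ ⊕ β` that are separated by `Sym.sep`. The machine reads
the topmost word and writes the output of `R` on the other tapes, as blocks of length at most `B`;
then the output words are moved to the main tape. -/
noncomputable def machineStep : State R.Q β k B → (Option (Fin k) → Sym (σ ⊕ β) β B) →
    Option (State R.Q β k B × (Option (Fin k) → Sym (σ ⊕ β) β B × Option Turing.Dir))
  | .idle, h => match h none with
    | .letter _ => some (.read R.init, fun t => stay (h t))
    | .sep => some (.idle, fun
      | none => (.blank, some .right)
      | some i => stay (h (some i)))
    | _ => none
  | .read q, h => match h none with
    | .letter a => some (.read (R.next q a), fun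
      | none => (.blank, some .right)
      | some i => (.cell (Block.cut B (R.write q a i)), some .left))
    | b => open Classical in if R.accept q then some (.unload (Fin.last k), fun
      | none => match b with
        | .sep => (.sep, some .left)
        | _ => stay (h none)
      | some i => (.cell (Block.cut B (R.last q i)), some .left)) else none
  | .unload j, h => Fin.cases
      (some (.idle, fun
        | none => (.blank, some .right)
        | some i => stay (h (some i))))
      (fun i => some (.move i (Block.cut B []), fun
        | none => (.sep, some .left)
        | some i' => if i' = i then (.blank, some .right) else stay (h (some i')))) j
  | .move i l, h => match l.1 with
    | a :: l => some (.move i (Block.cut B l), fun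
      | none => (.letter (Sum.inr a), some .left)
      | some i' => stay (h (some i')))
    | [] => match h (some i) with
      | .cell l => some (.move i (Block.cut B l.1.reverse), fun
        | none => stay (h none)
        | some i' => if i' = i then (.blank, some .right) else stay (h (some i')))
      | _ => some (.unload i.castSucc, fun t => stay (h t))

/-- The machine that iterates a transducer, on input words over `τ`. -/
noncomputable def machine {τ : Type*} (e : τ ↪ σ) [Finite σ] [Finite β] : MultiTapeTM τ where
  K := Option (Fin k)
  Γ := Sym (σ ⊕ β) β B
  Q := State R.Q β k B
  finiteK := inferInstance
  finiteΓ := inferInstance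
  finiteQ := have := R.finiteQ; inferInstance
  inputTape := none
  blank := .blank
  symbol := ⟨fun a => .letter (Sum.inl (e a)), fun a b h => by simpa using h⟩
  symbol_ne_blank := by simp
  start := .idle
  accept := {.idle}
  δ := R.machineStep B

/-! ### Single steps of the machine -/

section

variable {τ : Type*} (e : τ ↪ σ) [Finite σ] [Finite β]

/-- The configuration of the machine with given state and tape contents. -/
noncomputable def cfg (q : State R.Q β k B) (m : List (Sym (σ ⊕ β) β B))
    (aux : Fin k → List (Sym (σ ⊕ β) β B)) : (R.machine B e).Cfg where
  state := q
  tape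
    | none => Turing.Tape.mk₁ (Γ := (R.machine B e).Γ) m
    | some i => Turing.Tape.mk₁ (Γ := (R.machine B e).Γ) (aux i)

variable {R B e}

/-- Separates the transition, which is mostly found by `rfl`, from the effect on each tape, which is
a push, a pop or no change. -/
theorem step_cfg {q q' : State R.Q β k B} {m m' : List (Sym (σ ⊕ β) β B)}
    {aux aux' : Fin k → List (Sym (σ ⊕ β) β B)}
    {f : Option (Fin k) → Sym (σ ⊕ β) β B × Option Turing.Dir}
    (h : R.machineStep B q (fun t => (((R.cfg B e q m aux).tape t).head :)) = some (q', f))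
    (hm : MultiTapeTM.updateTape ((R.cfg B e q m aux).tape none) (f none) =
      (R.cfg B e q' m' aux').tape none)
    (haux : ∀ i, MultiTapeTM.updateTape ((R.cfg B e q m aux).tape (some i)) (f (some i)) =
      (R.cfg B e q' m' aux').tape (some i)) :
    (R.cfg B e q m aux).step = R.cfg B e q' m' aux' := by
  have h' : (R.cfg B e q m aux).transition = some (q', f) := h
  have : (R.cfg B e q m aux).step =
      ⟨q', fun t => MultiTapeTM.updateTape ((R.cfg B e q m aux).tape t) (f t)⟩ := by
    simp only [MultiTapeTM.Cfg.step, h']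
  rw [this]
  refine congrArg (MultiTapeTM.Cfg.mk (M := R.machine B e) q') (funext fun t => ?_)
  rcases t with _ | i
  · exact hm
  · exact haux i

theorem step_idle_sep (m : List (Sym (σ ⊕ β) β B)) (aux) :
    (R.cfg B e .idle (.sep :: m) aux).step = R.cfg B e .idle m aux :=
  step_cfg rfl (MultiTapeTM.updateTape_right _) fun _ => MultiTapeTM.updateTape_stay _ _ rfl

theorem step_idle_letter (a : σ ⊕ β) (m : List (Sym (σ ⊕ β) β B)) (aux) :
    (R.cfg B e .idle (.letter a :: m) aux).step =
      R.cfg B e (.read R.init) (.letter a :: m) aux :=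
  step_cfg rfl (MultiTapeTM.updateTape_stay _ _ rfl)
    fun _ => MultiTapeTM.updateTape_stay _ _ rfl

theorem step_read_letter (q : R.Q) (a : σ ⊕ β) (m : List (Sym (σ ⊕ β) β B)) (aux) :
    (R.cfg B e (.read q) (.letter a :: m) aux).step =
      R.cfg B e (.read (R.next q a)) m fun i =>
        .blank :: .cell (Block.cut B (R.write q a i)) :: (aux i).tail :=
  step_cfg rfl (MultiTapeTM.updateTape_right _) fun _ => MultiTapeTM.updateTape_left _ _

/-- At the bottom of the stack no separator follows the word: the head already scans a blank cell
and must not move, unlike in `step_read_sep`. -/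
theorem step_read_nil {q : R.Q} (hq : R.accept q) (aux) :
    (R.cfg B e (.read q) [] aux).step =
      R.cfg B e (.unload (Fin.last k)) [.blank] fun i =>
        .blank :: .cell (Block.cut B (R.last q i)) :: (aux i).tail :=
  step_cfg (if_pos hq)
    ((MultiTapeTM.updateTape_stay _ _ rfl).trans MultiTapeTM.tape_singleton_blank.symm)
    fun _ => MultiTapeTM.updateTape_left _ _

theorem step_read_sep {q : R.Q} (hq : R.accept q) (m : List (Sym (σ ⊕ β) β B)) (aux) :
    (R.cfg B e (.read q) (.sep :: m) aux).step =
      R.cfg B e (.unload (Fin.last k)) (.blank :: .sep :: m) fun i =>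
        .blank :: .cell (Block.cut B (R.last q i)) :: (aux i).tail :=
  step_cfg (if_pos hq) (MultiTapeTM.updateTape_left _ _) fun _ => MultiTapeTM.updateTape_left _ _

theorem halted_read {q : R.Q} (hq : ¬ R.accept q) (m : List (Sym (σ ⊕ β) β B)) (aux)
    (hm : m = [] ∨ ∃ m', m = .sep :: m') : (R.cfg B e (.read q) m aux).Halted := by
  rcases hm with rfl | ⟨m', rfl⟩ <;> exact if_neg hq

theorem step_unload_zero (m : List (Sym (σ ⊕ β) β B)) (aux) :
    (R.cfg B e (.unload 0) (.blank :: m) aux).step = R.cfg B e .idle m aux :=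
  step_cfg rfl (MultiTapeTM.updateTape_right _) fun _ => MultiTapeTM.updateTape_stay _ _ rfl

theorem step_unload_succ (i : Fin k) (m : List (Sym (σ ⊕ β) β B)) (aux) :
    (R.cfg B e (.unload i.succ) (.blank :: m) aux).step =
      R.cfg B e (.move i (Block.cut B [])) (.blank :: .sep :: m)
        (Function.update aux i (aux i).tail) := by
  refine step_cfg rfl (MultiTapeTM.updateTape_left _ _) fun i' => ?_
  by_cases h : i' = i
  · subst h
    simp only [if_true, cfg, Function.update_self]
    exact MultiTapeTM.updateTape_right _
  · simp only [h, if_false, cfg, Function.update_of_ne, Ne, not_false_eq_true]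
    exact MultiTapeTM.updateTape_stay _ _ rfl

theorem step_move_cons (i : Fin k) (a : β) (l : List β) (hl : (a :: l).length ≤ B)
    (m : List (Sym (σ ⊕ β) β B)) (aux) :
    (R.cfg B e (.move i ⟨a :: l, hl⟩) (.blank :: m) aux).step =
      R.cfg B e (.move i (Block.cut B l)) (.blank :: .letter (Sum.inr a) :: m) aux :=
  step_cfg rfl (MultiTapeTM.updateTape_left _ _) fun _ => MultiTapeTM.updateTape_stay _ _ rfl

theorem step_move_cell (i : Fin k) (l : Block β B) (L : List (Sym (σ ⊕ β) β B))
    (m : List (Sym (σ ⊕ β) β B)) (aux) (haux : aux i = .cell l :: L) :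
    (R.cfg B e (.move i ⟨[], Nat.zero_le _⟩) m aux).step =
      R.cfg B e (.move i (Block.cut B l.1.reverse)) m (Function.update aux i L) := by
  have hL : L = (aux i).tail := by rw [haux]; rfl
  have hh : (((R.cfg B e (.move i ⟨[], Nat.zero_le _⟩) m aux).tape (some i)).head :) =
      Sym.cell l := by
    simp only [cfg, haux]; rfl
  refine step_cfg (f := fun
        | none => stay (((R.cfg B e (.move i ⟨[], Nat.zero_le _⟩) m aux).tape none).head :)
        | some i' => if i' = i then (.blank, some .right) else
            stay (((R.cfg B e (.move i ⟨[], Nat.zero_le _⟩) m aux).tape (some i')).head :)) ?_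
      (MultiTapeTM.updateTape_stay _ _ rfl) fun i' => ?_
  · simp only [machineStep, hh]
  · by_cases h : i' = i
    · subst h
      simp only [if_true, cfg, Function.update_self, hL]
      exact MultiTapeTM.updateTape_right _
    · simp only [h, if_false, cfg, Function.update_of_ne, Ne, not_false_eq_true]
      exact MultiTapeTM.updateTape_stay _ _ rfl

theorem step_move_nil (i : Fin k) (m : List (Sym (σ ⊕ β) β B)) (aux) (haux : aux i = []) :
    (R.cfg B e (.move i ⟨[], Nat.zero_le _⟩) m aux).step =
      R.cfg B e (.unload i.castSucc) m (Function.update aux i [.blank]) := by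
  have hh : (((R.cfg B e (.move i ⟨[], Nat.zero_le _⟩) m aux).tape (some i)).head :) =
      (Sym.blank : Sym (σ ⊕ β) β B) := by
    simp only [cfg, haux]; rfl
  refine step_cfg (f := fun t =>
    stay (((R.cfg B e (.move i ⟨[], Nat.zero_le _⟩) m aux).tape t).head :)) ?_
    (MultiTapeTM.updateTape_stay _ _ rfl) fun i' => ?_
  · simp only [machineStep, hh]
  · refine (MultiTapeTM.updateTape_stay _ _ rfl).trans ?_
    by_cases h : i' = i
    · subst h
      simp only [cfg, Function.update_self, haux]
      exact MultiTapeTM.tape_singleton_blank.symm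
    · simp only [h, cfg, Function.update_of_ne, Ne, not_false_eq_true]

end

end Transducer

/-! ### Correctness and running time of the iterated transducer -/

namespace Transducer

variable {β : Type} {k : ℕ} {σ : Type} {R : Transducer (σ ⊕ β) β k} {B : ℕ}

open MultiTapeTM

theorem cut_nil : Block.cut B ([] : List β) = ⟨[], Nat.zero_le _⟩ :=
  Subtype.ext (by simp [Block.cut])

/-- The blocks that are written on an auxiliary tape when a word is read; the last block comes
first. -/
def blocks (R : Transducer (σ ⊕ β) β k) (B : ℕ) :
    R.Q → List (σ ⊕ β) → Fin k → List (Block β B) → List (Block β B)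
  | _, [], _, L => L
  | q, a :: w, i, L => blocks R B (R.next q a) w i (Block.cut B (R.write q a i) :: L)

theorem length_blocks (q : R.Q) (w : List (σ ⊕ β)) (i : Fin k) (L : List (Block β B)) :
    (blocks R B q w i L).length = w.length + L.length := by
  induction w generalizing q L with
  | nil => simp [blocks]
  | cons a w ih => simp only [blocks, ih, List.length_cons]; omega

/-- `Block.cut` truncates; the output survives in full because of `hB`. -/
theorem flatten_blocks (hB : ∀ q a i, (R.write q a i).length ≤ B) (q : R.Q) (w : List (σ ⊕ β))
    (i : Fin k) (L : List (Block β B)) :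
    ((blocks R B q w i L).reverse.map Subtype.val).flatten ++ R.last (R.run q w) i =
      (L.reverse.map Subtype.val).flatten ++ R.output q w i := by
  induction w generalizing q L with
  | nil => simp [blocks, output, run]
  | cons a w ih =>
    rw [blocks, run, ih, output]
    simp [Block.cut_val (hB q a i)]

variable {τ : Type*} {e : τ ↪ σ} [Finite σ] [Finite β]

/-- The tape symbols of a word over the input letters and the output letters of a transducer. -/
abbrev letters (B : ℕ) (w : List (σ ⊕ β)) : List (Sym (σ ⊕ β) β B) := w.map Sym.letter

/-- The tape symbols of a word over the output letters of a transducer. -/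
abbrev outLetters (σ : Type) (B : ℕ) (w : List β) : List (Sym (σ ⊕ β) β B) :=
  letters B (w.map Sum.inr)

/-- Moving the remaining letters of a block to the main tape. -/
theorem move_block (i : Fin k) (l : List β) (hl : l.length ≤ B) (m : List (Sym (σ ⊕ β) β B))
    (aux) : LeadsTo (R.cfg B e (.move i (Block.cut B l)) (.blank :: m) aux) l.length
      (R.cfg B e (.move i (Block.cut B [])) (.blank :: (outLetters σ B l.reverse ++ m)) aux) := by
  induction l generalizing m with
  | nil => exact LeadsTo.refl _
  | cons a l ih =>
    have h1 : Block.cut B (a :: l) = ⟨a :: l, hl⟩ := Subtype.ext (Block.cut_val hl)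
    have h2 := ih (Nat.le_of_succ_le hl) (.letter (Sum.inr a) :: m)
    rw [h1]
    have h3 : outLetters σ B l.reverse ++ .letter (Sum.inr a) :: m =
        outLetters σ B (a :: l).reverse ++ m := by simp
    rw [h3] at h2
    exact ((LeadsTo.of_step (step_move_cons i a l hl m aux)).trans h2).mono
      (by simp [Nat.add_comm])

/-- Moving the contents of an auxiliary tape to the main tape. -/
theorem move_cells (i : Fin k) (L : List (Block β B)) (m : List (Sym (σ ⊕ β) β B)) (aux)
    (haux : aux i = L.map Sym.cell) :
    LeadsTo (R.cfg B e (.move i (Block.cut B [])) (.blank :: m) aux) (L.length * (B + 1) + 1)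
      (R.cfg B e (.unload i.castSucc)
        (.blank :: (outLetters σ B (L.reverse.map Subtype.val).flatten ++ m))
        (Function.update aux i [.blank])) := by
  induction L generalizing m aux with
  | nil =>
    rw [cut_nil]
    simpa using LeadsTo.of_step (step_move_nil i (.blank :: m) aux haux)
  | cons l L ih =>
    have h1 : LeadsTo (R.cfg B e (.move i (Block.cut B [])) (.blank :: m) aux) 1
        (R.cfg B e (.move i (Block.cut B l.1.reverse)) (.blank :: m)
          (Function.update aux i (L.map Sym.cell))) := by
      rw [cut_nil]
      exact LeadsTo.of_step (step_move_cell i l _ _ aux haux)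
    -- Pushing reverses the order. The blocks come off the auxiliary tape last first, as needed, but
    -- inside a block the letters must be pushed last first too, whence `l.1.reverse`.
    have h2 := move_block (R := R) (e := e) i l.1.reverse (by simpa using l.2) m
      (Function.update aux i (L.map Sym.cell))
    have h3 := ih (outLetters σ B l.1 ++ m) (Function.update aux i (L.map Sym.cell)) (by simp)
    rw [List.reverse_reverse] at h2
    have h4 : outLetters σ B (L.reverse.map Subtype.val).flatten ++ (outLetters σ B l.1 ++ m) =
        outLetters σ B ((l :: L).reverse.map Subtype.val).flatten ++ m := by simp
    rw [h4, Function.update_idem] at h3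
    refine ((h1.trans h2).trans h3).mono ?_
    have := l.2
    simp only [List.length_reverse, List.length_cons]
    nlinarith

/-- The contents of the main tape when the words `W i` have been put on the stack. -/
def stacked (B : ℕ) (W : Fin k → List β) (m : List (Sym (σ ⊕ β) β B)) :
    List (Fin k) → List (Sym (σ ⊕ β) β B)
  | [] => m
  | i :: is => outLetters σ B (W i) ++ .sep :: stacked B W m is

/-- The auxiliary tapes when they are empty. -/
abbrev emptyAux (σ β : Type) (k B : ℕ) : Fin k → List (Sym (σ ⊕ β) β B) := fun _ => [.blank]

/-- Moving the contents of all the auxiliary tapes to the main tape. -/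
theorem unload (L : Fin k → List (Block β B)) (N : ℕ) (hN : ∀ i, (L i).length ≤ N)
    (m : List (Sym (σ ⊕ β) β B)) (j : ℕ) (hj : j ≤ k) :
    LeadsTo (R.cfg B e (.unload ⟨j, Nat.lt_succ_of_le hj⟩)
        (.blank :: stacked B (fun i => ((L i).reverse.map Subtype.val).flatten) m
          ((List.finRange k).drop j))
        (fun i => .blank :: if i.1 < j then (L i).map Sym.cell else []))
      (j * (N * (B + 1) + 2) + 1)
      (R.cfg B e .idle (stacked B (fun i => ((L i).reverse.map Subtype.val).flatten) m
        (List.finRange k)) (emptyAux σ β k B)) := by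
  -- The tapes of index below `j` are still full, and the words of the others are on the stack
  -- already. Tapes are emptied in descending order, so that the word with index 0 ends up on top.
  induction j with
  | zero =>
    simpa using LeadsTo.of_step (step_unload_zero (R := R) (e := e) _ _)
  | succ j ih =>
    have hj' : j < k := hj
    have h1 := LeadsTo.of_step (step_unload_succ (R := R) (e := e) ⟨j, hj'⟩
      (stacked B (fun i => ((L i).reverse.map Subtype.val).flatten) m
          ((List.finRange k).drop (j + 1)))
      (fun i => .blank :: if i.1 < j + 1 then (L i).map Sym.cell else []))
    have h2 := move_cells (R := R) (e := e) ⟨j, hj'⟩ (L ⟨j, hj'⟩)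
      (.sep :: stacked B (fun i => ((L i).reverse.map Subtype.val).flatten) m
          ((List.finRange k).drop (j + 1)))
      (Function.update (fun i => .blank :: if i.1 < j + 1 then (L i).map Sym.cell else [])
        ⟨j, hj'⟩ ((L ⟨j, hj'⟩).map Sym.cell)) (by simp)
    have h3 := ih hj'.le
    have hd : (List.finRange k).drop j = ⟨j, hj'⟩ :: (List.finRange k).drop (j + 1) := by
      rw [List.drop_eq_getElem_cons (by simpa using hj')]
      simp
    rw [hd, stacked] at h3
    simp only [List.tail_cons, Nat.lt_succ_self, if_true] at h1
    rw [Function.update_idem] at h2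
    have haux : Function.update (fun i : Fin k => (.blank : Sym (σ ⊕ β) β B) ::
        if i.1 < j + 1 then (L i).map Sym.cell else []) ⟨j, hj'⟩ [.blank] =
        fun i => .blank :: if i.1 < j then (L i).map Sym.cell else [] := by
      funext i
      by_cases h : i = ⟨j, hj'⟩
      · subst h; simp
      · have h' : i.1 ≠ j := fun h' => h (Fin.ext h')
        have : i.1 < j + 1 ↔ i.1 < j := by omega
        simp only [Function.update_of_ne h, this]
    rw [haux] at h2
    refine ((h1.trans h2).trans h3).mono ?_
    have := Nat.mul_le_mul_right (B + 1) (hN ⟨j, hj'⟩)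
    have h4 : (j + 1) * (N * (B + 1) + 2) = j * (N * (B + 1) + 2) + (N * (B + 1) + 2) := by ring
    rw [h4]
    omega

/-- Reading a word. -/
theorem read_word (q : R.Q) (w : List (σ ⊕ β)) (m : List (Sym (σ ⊕ β) β B))
    (L : Fin k → List (Block β B)) :
    LeadsTo (R.cfg B e (.read q) (letters B w ++ m) fun i => .blank :: (L i).map Sym.cell)
      w.length (R.cfg B e (.read (R.run q w)) m
        fun i => .blank :: (blocks R B q w i (L i)).map Sym.cell) := by
  induction w generalizing q L with
  | nil => exact LeadsTo.refl _
  | cons a w ih =>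
    have h1 := LeadsTo.of_step (step_read_letter (R := R) (e := e) q a (letters B w ++ m)
      fun i => .blank :: (L i).map Sym.cell)
    have h2 := ih (R.next q a) fun i => Block.cut B (R.write q a i) :: L i
    rw [List.length_cons, Nat.add_comm]
    exact h1.trans h2

/-- The rest of the stack below the topmost word. -/
def IsRest (m : List (Sym (σ ⊕ β) β B)) : Prop := m = [] ∨ ∃ m', m = .sep :: m'

/-- Processing the topmost word of the stack. -/
theorem process (hB : ∀ q a i, (R.write q a i).length ≤ B) (hB' : ∀ q i, (R.last q i).length ≤ B)
    (w : List (σ ⊕ β)) (hw : w ≠ []) (m : List (Sym (σ ⊕ β) β B)) (hm : IsRest m) :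
    TestsTo (R.cfg B e .idle (letters B w ++ m) (emptyAux σ β k B))
      ((w.length + 1) * (3 + k * (B + 3))) (R.Accepts w)
      (R.cfg B e .idle (stacked B (R.child w) m (List.finRange k)) (emptyAux σ β k B)) := by
  have h1 : LeadsTo (R.cfg B e .idle (letters B w ++ m) (emptyAux σ β k B)) 1
      (R.cfg B e (.read R.init) (letters B w ++ m) (emptyAux σ β k B)) := by
    obtain ⟨a, w, rfl⟩ := List.exists_cons_of_ne_nil hw
    exact LeadsTo.of_step (step_idle_letter a _ _)
  have h2 := read_word (R := R) (e := e) R.init w m fun _ => []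
  have h12 := h1.trans h2
  have hbound : (w.length + 1) * (3 + k * (B + 3)) =
      3 * w.length + 3 + k * ((w.length + 1) * (B + 1) + 2) + 2 * k * w.length := by ring
  by_cases hq : R.accept (R.run R.init w)
  · refine LeadsTo.testsTo ?_ hq
    set L : Fin k → List (Block β B) := fun i =>
      Block.cut B (R.last (R.run R.init w) i) :: blocks R B R.init w i [] with hL
    have h3 : LeadsTo (R.cfg B e (.read (R.run R.init w)) m
        fun i => .blank :: (blocks R B R.init w i []).map Sym.cell) 1
        (R.cfg B e (.unload (Fin.last k)) (.blank :: m) fun i => .blank :: (L i).map Sym.cell) := by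
      rcases hm with rfl | ⟨m', rfl⟩
      · exact LeadsTo.of_step (step_read_nil hq _)
      · exact LeadsTo.of_step (step_read_sep hq _ _)
    have h4 := unload (R := R) (e := e) L (w.length + 1)
      (fun i => by simp [hL, length_blocks]) m k le_rfl
    have hout : (fun i => ((L i).reverse.map Subtype.val).flatten) = R.child w := by
      funext i
      have := flatten_blocks hB R.init w i []
      simpa [hL, Block.cut_val (hB' _ i), child] using this
    rw [hout] at h4
    simp only [Fin.is_lt, if_true, List.drop_of_length_le (List.length_finRange).le, stacked] at h4
    refine ((h12.trans h3).trans h4).mono ?_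
    rw [hbound]
    omega
  · exact ⟨fun h => absurd h hq, fun _ => ⟨_, h12.mono (by rw [hbound]; omega),
      halted_read hq _ _ hm,
      fun h => by cases (show (State.read _ : State R.Q β k B) = .idle from h)⟩⟩

/-- Testing all the words that a transducer has put on the stack. -/
theorem tests_stacked (W : Fin k → List β) (t : Fin k → ℕ) (p : Fin k → Prop)
    (m : List (Sym (σ ⊕ β) β B))
    (h : ∀ i m, IsRest m → TestsTo (R.cfg B e .idle (outLetters σ B (W i) ++ m) (emptyAux σ β k B))
      (t i) (p i) (R.cfg B e .idle m (emptyAux σ β k B))) (is : List (Fin k)) :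
    TestsTo (R.cfg B e .idle (stacked B W m is) (emptyAux σ β k B))
      (is.map fun i => t i + 1).sum (∀ i ∈ is, p i) (R.cfg B e .idle m (emptyAux σ β k B)) := by
  induction is with
  | nil => exact (LeadsTo.refl _).testsTo (by simp)
  | cons i is ih =>
    have h1 := h i (.sep :: stacked B W m is) (Or.inr ⟨_, rfl⟩)
    have h2 := (LeadsTo.of_step (step_idle_sep (R := R) (e := e) (stacked B W m is)
      (emptyAux σ β k B))).testsTo trivial
    exact ((h1.trans h2).trans ih).mono (by simp) (by simp)

variable {P : List (σ ⊕ β) → Prop} {T : List β → ℕ}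

/-- The processing of a word together with all its descendants. -/
theorem tests_of_children (hB : ∀ q a i, (R.write q a i).length ≤ B)
    (hB' : ∀ q i, (R.last q i).length ≤ B)
    (hP : ∀ w ≠ [], (P w ↔ R.Accepts w ∧ ∀ i, P ((R.child w i).map Sum.inr)))
    (w : List (σ ⊕ β)) (hw : w ≠ []) (C : ℕ) (hC : 3 + k * (B + 4) ≤ C)
    (h : ∀ i m, IsRest m → TestsTo
      (R.cfg B e .idle (outLetters σ B (R.child w i) ++ m) (emptyAux σ β k B))
      (C * T (R.child w i)) (P ((R.child w i).map Sum.inr))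
      (R.cfg B e .idle m (emptyAux σ β k B)))
    (m : List (Sym (σ ⊕ β) β B)) (hm : IsRest m) :
    TestsTo (R.cfg B e .idle (letters B w ++ m) (emptyAux σ β k B))
      (C * (w.length + 1 + ∑ i, T (R.child w i))) (P w)
      (R.cfg B e .idle m (emptyAux σ β k B)) := by
  refine ((process hB hB' w hw m hm).trans
    (tests_stacked _ _ _ m h (List.finRange k))).mono ?_ ?_
  · have h1 : ((List.finRange k).map fun i => C * T (R.child w i) + 1).sum =
        C * ∑ i, T (R.child w i) + k := by
      rw [List.sum_map_add, ← Fin.sum_univ_def, Finset.mul_sum]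
      simp
    rw [h1]
    -- The factor `3 + k * (B + 3)` per letter pays for reading and unloading; the additional `k`
    -- pays for removing the separators after the `k` children.
    have h2 : (w.length + 1) * (3 + k * (B + 3)) + k ≤ C * (w.length + 1) := by
      refine le_trans ?_ (Nat.mul_le_mul_right _ hC)
      nlinarith [Nat.zero_le (k * w.length)]
    have h3 : C * (w.length + 1 + ∑ i, T (R.child w i)) =
        C * (w.length + 1) + C * ∑ i, T (R.child w i) := Nat.mul_add _ _ _
    omega
  · rw [hP w hw]
    simp

/-- By `hT` the potential of a nonempty word exceeds that of each child, which gives the induction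
on `n`; the surplus `u.length + 1` pays for processing `u` itself. An empty word takes no time, as
its separator is charged to the parent. -/
theorem tests_word (hB : ∀ q a i, (R.write q a i).length ≤ B)
    (hB' : ∀ q i, (R.last q i).length ≤ B) (hP0 : P [])
    (hP : ∀ w ≠ [], (P w ↔ R.Accepts w ∧ ∀ i, P ((R.child w i).map Sum.inr)))
    (hT : ∀ u ≠ [], u.length + 1 + ∑ i, T (R.child (u.map Sum.inr) i) ≤ T u)
    (C : ℕ) (hC : 3 + k * (B + 4) ≤ C) (n : ℕ) (u : List β) (hu : T u ≤ n)
    (m : List (Sym (σ ⊕ β) β B)) (hm : IsRest m) :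
    TestsTo (R.cfg B e .idle (outLetters σ B u ++ m) (emptyAux σ β k B))
      (C * T u) (P (u.map Sum.inr)) (R.cfg B e .idle m (emptyAux σ β k B)) := by
  induction n generalizing u m with
  | zero =>
    rcases eq_or_ne u [] with rfl | hne
    · exact ((LeadsTo.refl _).mono (Nat.zero_le _)).testsTo hP0
    · have := hT u hne
      omega
  | succ n ih =>
    rcases eq_or_ne u [] with rfl | hne
    · exact ((LeadsTo.refl _).mono (Nat.zero_le _)).testsTo hP0
    · refine (tests_of_children hB hB' hP (u.map Sum.inr) (by simpa using hne) C hC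
        (fun i m hm => ih _ ?_ m hm) m hm).mono ?_ Iff.rfl
      · have h1 := Finset.single_le_sum
          (f := fun i => T (R.child (u.map Sum.inr) i)) (fun _ _ => Nat.zero_le _)
          (Finset.mem_univ i)
        have h2 := hT u hne
        omega
      · simpa using Nat.mul_le_mul_left C (hT u hne)

/-- A property of words that holds for a word if and only if a transducer accepts this word and
the property holds for all the output words is decidable in the time that is given by the sum of
the lengths of all the words that arise. -/
theorem exists_decidesInTime (R : Transducer (σ ⊕ β) β k) (e : τ ↪ σ) (P : List (σ ⊕ β) → Prop)
    (T : List β → ℕ) (hP0 : P [])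
    (hP : ∀ w ≠ [], (P w ↔ R.Accepts w ∧ ∀ i, P ((R.child w i).map Sum.inr)))
    (hT : ∀ u ≠ [], u.length + 1 + ∑ i, T (R.child (u.map Sum.inr) i) ≤ T u)
    (g : ℕ → ℕ)
    (hg : ∀ w : List τ, ∑ i, T (R.child (w.map fun a => Sum.inl (e a)) i) ≤ g w.length) :
    ∃ (M : MultiTapeTM τ) (C : ℕ), M.DecidesInTime {w | P (w.map fun a => Sum.inl (e a))}
      fun n => C * (n + 1 + g n) := by
  obtain ⟨B, hB, hB'⟩ := R.exists_bound
  refine ⟨R.machine B e, 3 + k * (B + 4), fun w => ?_⟩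
  set C := 3 + k * (B + 4)
  set w' : List (σ ⊕ β) := w.map fun a => Sum.inl (e a) with hw'
  have hinit : (R.machine B e).initCfg w =
      R.cfg B e .idle (letters B w' ++ []) (emptyAux σ β k B) := by
    refine congrArg (MultiTapeTM.Cfg.mk (M := R.machine B e) _) (funext fun t => ?_)
    rcases t with _ | i
    · refine (if_pos rfl).trans ?_
      simp [hw']
      rfl
    · exact (if_neg (by exact Option.some_ne_none i)).trans MultiTapeTM.tape_singleton_blank.symm
  have key : TestsTo ((R.machine B e).initCfg w) (C * (w.length + 1 + g w.length)) (P w')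
      (R.cfg B e .idle [] (emptyAux σ β k B)) := by
    rw [hinit]
    rcases eq_or_ne w [] with rfl | hne
    · exact ((LeadsTo.refl _).mono (Nat.zero_le _)).testsTo hP0
    · refine (tests_of_children hB hB' hP w' (by simpa [hw'] using hne) C le_rfl
        (fun i m hm => tests_word hB hB' hP0 hP hT C le_rfl _ _ le_rfl m hm) [] (Or.inl rfl)).mono
        (Nat.mul_le_mul_left C ?_) Iff.rfl
      simpa [hw'] using hg w
  -- With the stack empty, the idle state scans a blank and has no transition; it is the only
  -- accepting state.
  have hidle : (R.cfg B e .idle [] (emptyAux σ β k B)).Halted := rfl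
  rw [MultiTapeTM.cfgAfter]
  change _ ∧ (_ ↔ P w')
  by_cases hp : P w'
  · rw [(key.1 hp).iterate_eq hidle]
    exact ⟨hidle, iff_of_true rfl hp⟩
  · obtain ⟨d, hd, hd1, hd2⟩ := key.2 hp
    rw [hd.iterate_eq hd1]
    exact ⟨hd1, iff_of_false hd2 hp⟩

end Transducer

/-! ### Words over the states of an automaton -/

namespace InvertibleAutomaton

variable {S X : Type*} (A : InvertibleAutomaton S X)

/-- The permutation of the alphabet that is defined by a word over the states. -/
def wordOut : List S → Equiv.Perm X
  | [] => 1
  | s :: w => (A.o s).trans (wordOut w)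

theorem wordPerm_apply_nil (w : List S) : A.wordPerm w [] = [] := by
  induction w with
  | nil => rfl
  | cons s w ih => exact ih

theorem wordPerm_apply_cons (w : List S) (x : X) (v : List X) :
    A.wordPerm w (x :: v) = A.wordOut w x :: A.wordPerm (A.wordSection w x) v := by
  induction w generalizing x v with
  | nil => rfl
  | cons s w ih => exact ih _ _

/-- Words act from left to right and permutations multiply from right to left, so `wordPerm`
reverses products. This is why generators are later translated via their inverses. -/
theorem wordPerm_append (u w : List S) :
    A.wordPerm (u ++ w) = A.wordPerm w * A.wordPerm u := by
  induction u with
  | nil => rfl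
  | cons s u ih =>
    rw [List.cons_append, wordPerm, ih]
    rfl

theorem wordOut_append (u w : List S) :
    A.wordOut (u ++ w) = (A.wordOut u).trans (A.wordOut w) := by
  induction u with
  | nil => rfl
  | cons s u ih =>
    rw [List.cons_append, wordOut, ih]
    rfl

theorem wordSection_append (u w : List S) (x : X) :
    A.wordSection (u ++ w) x = A.wordSection u x ++ A.wordSection w (A.wordOut u x) := by
  induction u generalizing x with
  | nil => rfl
  | cons s u ih =>
    rw [List.cons_append, wordSection, ih]
    rfl

/-- This equivalence is the recursion that the machine carries out. -/
theorem wordPerm_eq_one_iff (w : List S) :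
    A.wordPerm w = 1 ↔ A.wordOut w = 1 ∧ ∀ x, A.wordPerm (A.wordSection w x) = 1 := by
  constructor
  · intro h
    have h' : ∀ x v, A.wordOut w x = x ∧ A.wordPerm (A.wordSection w x) v = v := fun x v => by
      have := A.wordPerm_apply_cons w x v
      rw [h] at this
      simpa [eq_comm] using this
    exact ⟨Equiv.ext fun x => (h' x []).1, fun x => Equiv.ext fun v => (h' x v).2⟩
  · rintro ⟨h1, h2⟩
    refine Equiv.ext fun v => ?_
    rcases v with _ | ⟨x, v⟩
    · exact A.wordPerm_apply_nil w
    · rw [wordPerm_apply_cons, h1, h2]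
      rfl

theorem exists_geodesic (w : List S) : ∃ u : List S, u.length = A.len w ∧
    A.wordPerm u = A.wordPerm w :=
  Nat.sInf_mem (s := {n | ∃ u : List S, u.length = n ∧ A.wordPerm u = A.wordPerm w})
    ⟨w.length, w, rfl, rfl⟩

/-- A shortest word that represents the same transformation as `w`. -/
noncomputable def geodesic (w : List S) : List S := (A.exists_geodesic w).choose

theorem length_geodesic (w : List S) : (A.geodesic w).length = A.len w :=
  (A.exists_geodesic w).choose_spec.1

theorem wordPerm_geodesic (w : List S) : A.wordPerm (A.geodesic w) = A.wordPerm w :=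
  (A.exists_geodesic w).choose_spec.2

theorem IsClosedUnderInversion.exists_wordPerm_eq {A : InvertibleAutomaton S X}
    (hA : A.IsClosedUnderInversion) {g : Equiv.Perm (List X)} (hg : g ∈ A.group) :
    ∃ w, A.wordPerm w = g := by
  have hinv : ∀ w, ∃ w', A.wordPerm w' = (A.wordPerm w)⁻¹ := fun w => by
    induction w with
    | nil => exact ⟨[], rfl⟩
    | cons s w ih =>
      obtain ⟨w', hw'⟩ := ih
      obtain ⟨s', hs'⟩ := hA s
      refine ⟨w' ++ [s'], ?_⟩
      rw [wordPerm_append, hw']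
      change A.perm s' * _ = (A.wordPerm w * A.perm s)⁻¹
      rw [hs', mul_inv_rev]
  induction hg using Subgroup.closure_induction with
  | mem g hg =>
    obtain ⟨s, rfl⟩ := hg
    exact ⟨[s], rfl⟩
  | one => exact ⟨[], rfl⟩
  | mul g h _ _ hg hh =>
    obtain ⟨u, rfl⟩ := hg
    obtain ⟨w, rfl⟩ := hh
    exact ⟨w ++ u, A.wordPerm_append w u⟩
  | inv g _ hg =>
    obtain ⟨u, rfl⟩ := hg
    exact hinv u

/-- A block in the middle of a word meets the letters permuted by `p`, the action of what precedes
it; the sum over all letters is not affected. -/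
theorem sum_length_geodesic_lt {S X : Type} [Fintype X] {A : InvertibleAutomaton S X} {k d : ℕ}
    {en : Fin d ≃ X} (hk : ∀ w : List S, k ≤ w.length →
    ∑ x, A.len (A.wordSection w x) < w.length) (p : Equiv.Perm X) (w : List S)
    (hw : k ≤ w.length) : ∑ i, (A.geodesic (A.wordSection w (p (en i)))).length < w.length := by
  refine lt_of_eq_of_lt ?_ (hk w hw)
  simp only [length_geodesic]
  exact (en.trans p).sum_comp fun x => A.len (A.wordSection w x)

end InvertibleAutomaton

theorem InvertibleAutomaton.group_fg {S X : Type*} [Finite S] (A : InvertibleAutomaton S X) :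
    Group.FG A.group :=
  Group.closure_finite_fg _

/-! ### Strongly contracting automata -/

namespace InvertibleAutomaton

variable {S X : Type} [Finite S] [Finite X] (A : InvertibleAutomaton S X) {σ : Type} (k : ℕ)
  (ex : σ ⊕ S → List S) {d : ℕ} (en : Fin d ≃ X)

/-- The transducer that computes short words for the sections of a word, block by block. It
remembers the permutation of the alphabet that is defined by what has been processed, and a part of
the word that has not been processed yet. -/
noncomputable def blockTransducer [NeZero k] : Transducer (σ ⊕ S) S d where
  Q := Equiv.Perm X × {b : List S // b.length < 2 * k}
  finiteQ := have : Finite {b : List S // b.length < 2 * k} := List.finite_length_lt S (2 * k)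
    inferInstance
  init := (1, ⟨[], by simp [Nat.pos_of_neZero k]⟩)
  -- Once `2 * k` letters are waiting, all but the last `k` form a block. It has at least `k`
  -- letters, so contraction applies, and the `k` letters left over make the final block long enough
  -- as well.
  next q l := if h : (q.2.1 ++ ex l).length < 2 * k then (q.1, ⟨q.2.1 ++ ex l, h⟩) else
    (q.1.trans (A.wordOut ((q.2.1 ++ ex l).take ((q.2.1 ++ ex l).length - k))),
      ⟨(q.2.1 ++ ex l).drop ((q.2.1 ++ ex l).length - k), by
        have := Nat.pos_of_neZero k
        rw [List.length_drop]
        omega⟩)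
  write q l i := if (q.2.1 ++ ex l).length < 2 * k then [] else
    A.geodesic (A.wordSection ((q.2.1 ++ ex l).take ((q.2.1 ++ ex l).length - k)) (q.1 (en i)))
  -- A remainder shorter than `k` means that no block has been processed; it is then the whole word,
  -- and its triviality can be read off from the state.
  accept q := if q.2.1.length < k then A.wordPerm q.2.1 = 1 else q.1.trans (A.wordOut q.2.1) = 1
  last q i := if q.2.1.length < k then [] else A.geodesic (A.wordSection q.2.1 (q.1 (en i)))

/-! ### The block transducer: correctness and contraction -/

variable [NeZero k] {A k ex en}

theorem blockTransducer_next_of_lt {q : (A.blockTransducer k ex en).Q} {l : σ ⊕ S}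
    (h : (q.2.1 ++ ex l).length < 2 * k) : ∃ q' : (A.blockTransducer k ex en).Q,
      (A.blockTransducer k ex en).next q l = q' ∧ q'.1 = q.1 ∧ q'.2.1 = q.2.1 ++ ex l ∧
      ∀ i, (A.blockTransducer k ex en).write q l i = [] :=
  ⟨_, dif_pos h, rfl, rfl, fun _ => if_pos h⟩

theorem blockTransducer_next_of_ge {q : (A.blockTransducer k ex en).Q} {l : σ ⊕ S}
    (h : 2 * k ≤ (q.2.1 ++ ex l).length) : ∃ (q' : (A.blockTransducer k ex en).Q) (c : List S),
      (A.blockTransducer k ex en).next q l = q' ∧ q'.1 = q.1.trans (A.wordOut c) ∧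
      q.2.1 ++ ex l = c ++ q'.2.1 ∧ q'.2.1.length = k ∧
      ∀ i, (A.blockTransducer k ex en).write q l i =
        A.geodesic (A.wordSection c (q.1 (en i))) :=
  ⟨_, _, dif_neg (not_lt.2 h), rfl, (List.take_append_drop _ _).symm, by
    simp only [List.length_drop]
    omega, fun _ => if_neg (not_lt.2 h)⟩

theorem blockTransducer_of_long (w : List (σ ⊕ S)) (q : (A.blockTransducer k ex en).Q)
    (hw : k ≤ (q.2.1 ++ w.flatMap ex).length) :
    ((A.blockTransducer k ex en).accept ((A.blockTransducer k ex en).run q w) ↔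
      q.1.trans (A.wordOut (q.2.1 ++ w.flatMap ex)) = 1) ∧
    ∀ i, A.wordPerm ((A.blockTransducer k ex en).output q w i) =
      A.wordPerm (A.wordSection (q.2.1 ++ w.flatMap ex) (q.1 (en i))) := by
  induction w generalizing q with
  | nil =>
    rw [List.flatMap_nil, List.append_nil] at hw ⊢
    refine ⟨iff_of_eq (if_neg (not_lt.2 hw)), fun i => ?_⟩
    have h : (A.blockTransducer k ex en).output q [] i =
      A.geodesic (A.wordSection q.2.1 (q.1 (en i))) := if_neg (not_lt.2 hw)
    rw [h, wordPerm_geodesic]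
  | cons l w ih =>
    rw [Transducer.run]
    simp only [Transducer.output]
    rw [List.flatMap_cons, ← List.append_assoc] at hw ⊢
    rcases lt_or_ge (q.2.1 ++ ex l).length (2 * k) with h | h
    · obtain ⟨q', hq', h1, h2, hwr⟩ := blockTransducer_next_of_lt h
      rw [← h2] at hw ⊢
      simp only [hq', hwr, List.nil_append, ← h1]
      exact ih q' hw
    · obtain ⟨q', c, hq', h1, h2, h3, hwr⟩ := blockTransducer_next_of_ge h
      rw [hq', h2, List.append_assoc]
      have := ih q' (by rw [List.length_append, h3]; omega)
      refine ⟨this.1.trans ?_, fun i => ?_⟩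
      · rw [h1, wordOut_append A c]
        rfl
      · rw [hwr, wordPerm_append, this.2, wordPerm_geodesic, wordSection_append A c,
          wordPerm_append, h1]
        rfl

theorem blockTransducer_of_short (w : List (σ ⊕ S)) (q : (A.blockTransducer k ex en).Q)
    (hw : (q.2.1 ++ w.flatMap ex).length < k) :
    ((A.blockTransducer k ex en).accept ((A.blockTransducer k ex en).run q w) ↔
      A.wordPerm (q.2.1 ++ w.flatMap ex) = 1) ∧
    ∀ i, (A.blockTransducer k ex en).output q w i = [] := by
  induction w generalizing q with
  | nil =>
    rw [List.flatMap_nil, List.append_nil] at hw ⊢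
    exact ⟨iff_of_eq (if_pos hw), fun i => if_pos hw⟩
  | cons l w ih =>
    rw [Transducer.run]
    simp only [Transducer.output]
    rw [List.flatMap_cons, ← List.append_assoc] at hw ⊢
    obtain ⟨q', hq', h1, h2, hwr⟩ := blockTransducer_next_of_lt (A := A) (en := en) (q := q)
      (l := l) (by rw [List.length_append] at hw; omega)
    rw [← h2] at hw ⊢
    simp only [hq', hwr, List.nil_append]
    exact ih q' hw

theorem accepts_blockTransducer_iff (w : List (σ ⊕ S)) :
    A.wordPerm (w.flatMap ex) = 1 ↔ (A.blockTransducer k ex en).Accepts w ∧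
      ∀ i, A.wordPerm ((A.blockTransducer k ex en).child w i) = 1 := by
  rcases lt_or_ge (w.flatMap ex).length k with h | h
  · have := blockTransducer_of_short (A := A) (en := en) w (A.blockTransducer k ex en).init h
    rw [Transducer.Accepts, this.1]
    simp only [Transducer.child, this.2]
    exact ⟨fun h => ⟨h, fun _ => rfl⟩, fun h => h.1⟩
  · have := blockTransducer_of_long (A := A) (en := en) w (A.blockTransducer k ex en).init h
    rw [Transducer.Accepts, this.1, wordPerm_eq_one_iff]
    simp only [Transducer.child, this.2]
    exact and_congr Iff.rfl (en.forall_congr_right (q := fun x =>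
      A.wordPerm (A.wordSection (w.flatMap ex) x) = 1)).symm

/-- Every block has at most `2 * k + E` letters and loses at least one of them when its sections are
replaced by geodesics; these relative losses add up over the blocks. -/
theorem sum_length_output_blockTransducer [Fintype X] (hk : ∀ w : List S, k ≤ w.length →
    ∑ x, A.len (A.wordSection w x) < w.length) {E : ℕ} (hE : ∀ l, (ex l).length ≤ E)
    (w : List (σ ⊕ S)) (q : (A.blockTransducer k ex en).Q)
    (hw : k ≤ (q.2.1 ++ w.flatMap ex).length) :
    (2 * k + E) * ∑ i, ((A.blockTransducer k ex en).output q w i).length +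
      (q.2.1 ++ w.flatMap ex).length ≤ (2 * k + E) * (q.2.1 ++ w.flatMap ex).length := by
  have key : ∀ (p : Equiv.Perm X) (b : List S), k ≤ b.length → b.length ≤ 2 * k + E →
      (2 * k + E) * ∑ i, (A.geodesic (A.wordSection b (p (en i)))).length + b.length ≤
        (2 * k + E) * b.length := fun p b hb hb' => by
    have := Nat.mul_le_mul_left (2 * k + E) (Nat.succ_le_of_lt
      (sum_length_geodesic_lt (en := en) hk p b hb))
    rw [Nat.succ_eq_add_one, Nat.mul_add] at this
    omega
  induction w generalizing q with
  | nil =>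
    rw [List.flatMap_nil, List.append_nil] at hw ⊢
    have h : ∀ i, (A.blockTransducer k ex en).output q [] i =
      A.geodesic (A.wordSection q.2.1 (q.1 (en i))) := fun i => if_neg (not_lt.2 hw)
    simp only [h]
    have := q.2.2
    exact key q.1 q.2.1 hw (by omega)
  | cons l w ih =>
    simp only [Transducer.output]
    rw [List.flatMap_cons, ← List.append_assoc] at hw ⊢
    rcases lt_or_ge (q.2.1 ++ ex l).length (2 * k) with h | h
    · obtain ⟨q', hq', h1, h2, hwr⟩ := blockTransducer_next_of_lt h
      rw [← h2] at hw ⊢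
      simp only [hq', hwr, List.nil_append]
      exact ih q' hw
    · obtain ⟨q', c, hq', h1, h2, h3, hwr⟩ := blockTransducer_next_of_ge h
      rw [hq', h2, List.append_assoc]
      have h4 := ih q' (by rw [List.length_append, h3]; omega)
      have h5 : (q.2.1 ++ ex l).length = c.length + k := by rw [h2, List.length_append, h3]
      have hl := hE l
      have hq := q.2.2
      have h6 := key q.1 c (by omega) (by rw [List.length_append] at h5; omega)
      simp only [hwr]
      rw [List.length_append (as := c), Nat.mul_add]
      simp only [List.length_append (bs := Transducer.output _ _ _ _), Finset.sum_add_distrib,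
        Nat.mul_add]
      omega

theorem sum_length_child_blockTransducer [Fintype X] (hk : ∀ w : List S, k ≤ w.length →
    ∑ x, A.len (A.wordSection w x) < w.length) {E : ℕ} (hE : ∀ l, (ex l).length ≤ E)
    (w : List (σ ⊕ S)) :
    (2 * k + E) * ∑ i, ((A.blockTransducer k ex en).child w i).length +
      (w.flatMap ex).length ≤ (2 * k + E) * (w.flatMap ex).length := by
  rcases lt_or_ge (w.flatMap ex).length k with h | h
  · have := blockTransducer_of_short (A := A) (en := en) w (A.blockTransducer k ex en).init h
    simp only [Transducer.child, this.2]
    have := Nat.pos_of_neZero k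
    simp only [List.length_nil, Finset.sum_const_zero, Nat.mul_zero, Nat.zero_add]
    exact Nat.le_mul_of_pos_left _ (by omega)
  · exact sum_length_output_blockTransducer hk hE w (A.blockTransducer k ex en).init h

theorem IsStronglyContracting.wordProblem_mem [Fintype X] {A : InvertibleAutomaton S X}
    (hA : A.IsStronglyContracting) (hA' : A.IsClosedUnderInversion) {G : Type*} [Group G]
    (φ : G ≃* A.group) (T : Finset G) :
    InMultiTapeDTIME (wordProblem T) fun n => (n : ℝ) := by
  obtain ⟨N, hN⟩ := hA
  -- The inverse compensates for the reversal in `wordPerm_append`.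
  have hu : ∀ a : T, ∃ u, A.wordPerm u = (φ a : Equiv.Perm (List X))⁻¹ := fun a =>
    hA'.exists_wordPerm_eq (inv_mem (φ a).2)
  choose u hu using hu
  let σ := Fin (Fintype.card T)
  let e : T ≃ σ := Fintype.equivFin T
  let ex : σ ⊕ S → List S := Sum.elim (fun a => u (e.symm a)) fun s => [s]
  obtain ⟨E, hE⟩ : ∃ E, ∀ l, (ex l).length ≤ E := by
    obtain ⟨E, hE⟩ := (Set.finite_range fun l => (ex l).length).bddAbove
    exact ⟨E, fun l => hE ⟨l, rfl⟩⟩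
  let en : Fin (Fintype.card X) ≃ X := (Fintype.equivFin X).symm
  -- `N + 1` instead of `N`, since the block length must be positive.
  have hk : ∀ w : List S, N + 1 ≤ w.length → ∑ x, A.len (A.wordSection w x) < w.length :=
    fun w hw => hN w (by omega)
  have hex : ∀ w : List S, (w.map Sum.inr).flatMap ex = w := fun w => by
    simp [ex, List.flatMap_map]
  let R := A.blockTransducer (N + 1) ex en
  set K := 2 * (N + 1) + E with hK
  have hlen : ∀ w, K * ∑ i, (R.child w i).length + (w.flatMap ex).length ≤
    K * (w.flatMap ex).length := sum_length_child_blockTransducer hk hE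
  -- By `hlen`, the potential `2 * K * u.length` exceeds the sum over the children by at least `2 *
  -- u.length`, which is at least `u.length + 1` if `u` is not empty.
  obtain ⟨M, C, hM⟩ := R.exists_decidesInTime e.toEmbedding
    (fun w => A.wordPerm (w.flatMap ex) = 1) (fun u => 2 * K * u.length) rfl
    (fun w _ => by
      rw [accepts_blockTransducer_iff (k := N + 1) (en := en)]
      simp only [hex]
      rfl)
    (fun v hv => by
      have h1 := hlen (v.map Sum.inr)
      rw [hex] at h1
      have h2 := List.length_pos_iff.2 hv
      rw [← Finset.mul_sum, Nat.mul_assoc, Nat.mul_assoc]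
      omega)
    (fun n => 2 * K * (E * n)) (fun w => by
      have h1 := hlen (w.map fun a => Sum.inl (e a))
      rw [← Finset.mul_sum, Nat.mul_assoc, Nat.mul_assoc]
      have h2 : ((w.map fun a => Sum.inl (e a)).flatMap ex).length ≤ E * w.length := by
        rw [List.length_flatMap, Nat.mul_comm]
        refine (List.sum_le_card_nsmul _ E ?_).trans (by simp)
        simp only [List.mem_map]
        rintro _ ⟨l, _, rfl⟩
        exact hE l
      have h3 := Nat.mul_le_mul_left K h2
      simp only [Equiv.coe_toEmbedding]
      omega)
  refine ⟨M, fun n => C * (n + 1 + 2 * K * (E * n)), ?_, ?_⟩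
  · suffices h : wordProblem T = {w | A.wordPerm
        ((w.map fun a => Sum.inl (e.toEmbedding a)).flatMap ex) = 1} by
      rw [h]
      exact hM
    ext w
    have : ∀ w : List T, A.wordPerm ((w.map fun a => Sum.inl (e a)).flatMap ex) =
        (φ (w.map Subtype.val).prod : Equiv.Perm (List X))⁻¹ := fun w => by
      induction w with
      | nil => simp [wordPerm]; rfl
      | cons a w ih =>
        rw [List.map_cons, List.flatMap_cons, wordPerm_append, ih]
        simp [ex, hu]
    change (w.map Subtype.val).prod = 1 ↔ A.wordPerm _ = 1
    simp only [Equiv.coe_toEmbedding]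
    rw [this w]
    simp
  · refine IsBigO.of_bound (C * (2 + 2 * K * E)) ?_
    filter_upwards [eventually_ge_atTop 1] with n hn
    have hn' : (1 : ℝ) ≤ n := by exact_mod_cast hn
    rw [Real.norm_of_nonneg (by positivity), Real.norm_of_nonneg (by positivity)]
    push_cast
    have : (C : ℝ) * (n + 1 + 2 * K * (E * n)) ≤ C * (n + n + 2 * K * (E * n)) := by gcongr
    linarith

end InvertibleAutomaton

/-! ### Directed and rooted automorphisms -/

/-- A directed automorphism `d` of the tree of words over `Y`: it permutes the first letter by
`perm`, its section at `pt` is `d` again, and its section at any other letter `y` permutes the first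
letter by `sec y`. -/
structure DirectedAut (Y : Type) where
  /-- the letter at which the section is the automorphism itself -/
  pt : Y
  /-- the permutation of the first letter -/
  perm : Equiv.Perm Y
  /-- the rooted sections -/
  sec : Y → Equiv.Perm Y

namespace DirectedAut

variable {Y : Type}

instance [Finite Y] : Finite (DirectedAut Y) :=
  Finite.of_injective (fun d => (d.pt, d.perm, d.sec)) fun d d' h => by
    cases d
    cases d'
    simpa using h

/-- A state that defines a directed automorphism or a rooted one, which permutes the first letter
only. -/
abbrev Letter (Y : Type) : Type := DirectedAut Y ⊕ Equiv.Perm Y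

open Classical in
/-- The automaton of all the directed and rooted automorphisms. -/
noncomputable def automaton (Y : Type) : InvertibleAutomaton (Letter Y) Y where
  t := Sum.elim (fun d y => if y = d.pt then Sum.inl d else Sum.inr (d.sec y))
    fun _ _ => Sum.inr 1
  o := Sum.elim DirectedAut.perm id

theorem out_rooted_one (v : List Y) : (automaton Y).out (Sum.inr 1) v = v := by
  induction v with
  | nil => rfl
  | cons y v ih => exact congrArg (y :: ·) ih

theorem out_rooted_cons (f : Equiv.Perm Y) (y : Y) (v : List Y) :
    (automaton Y).out (Sum.inr f) (y :: v) = f y :: v :=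
  congrArg (f y :: ·) (out_rooted_one v)

theorem out_directed_pt (d : DirectedAut Y) (v : List Y) :
    (automaton Y).out (Sum.inl d) (d.pt :: v) =
      d.perm d.pt :: (automaton Y).out (Sum.inl d) v := by
  simp [InvertibleAutomaton.out, automaton]

theorem out_directed_cons_of_ne {d : DirectedAut Y} {y : Y} (h : y ≠ d.pt) (v : List Y) :
    (automaton Y).out (Sum.inl d) (y :: v) =
      d.perm y :: (automaton Y).out (Sum.inr (d.sec y)) v := by
  simp [InvertibleAutomaton.out, automaton, h]

theorem perm_rooted_one : (automaton Y).perm (Sum.inr 1) = 1 := Equiv.ext out_rooted_one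

theorem perm_rooted_mul (f g : Equiv.Perm Y) :
    (automaton Y).perm (Sum.inr g) * (automaton Y).perm (Sum.inr f) =
      (automaton Y).perm (Sum.inr (f.trans g)) := by
  refine Equiv.ext fun v => ?_
  change (automaton Y).out _ ((automaton Y).out _ v) = (automaton Y).out _ v
  rcases v with _ | ⟨y, v⟩
  · rfl
  · simp only [out_rooted_cons]
    rfl

/-- The product of two directed automorphisms that is directed if the first one maps its special
letter to that of the second one. -/
def merge (d d' : DirectedAut Y) : DirectedAut Y where
  pt := d.pt
  perm := d.perm.trans d'.perm
  sec y := (d.sec y).trans (d'.sec (d.perm y))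

/-- By `h`, the section of the product at `d.pt` is the product itself, which closes the induction;
at the other letters both factors have rooted sections. -/
theorem perm_merge {d d' : DirectedAut Y} (h : d.perm d.pt = d'.pt) :
    (automaton Y).perm (Sum.inl d') * (automaton Y).perm (Sum.inl d) =
      (automaton Y).perm (Sum.inl (merge d d')) := by
  refine Equiv.ext fun v => ?_
  change (automaton Y).out _ ((automaton Y).out _ v) = (automaton Y).out _ v
  induction v with
  | nil => rfl
  | cons y v ih =>
    by_cases hy : y = d.pt
    · subst hy
      rw [out_directed_pt, h, out_directed_pt, ih]
      have := out_directed_pt (merge d d') v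
      simpa [merge, h] using this.symm
    · have hy' : d.perm y ≠ d'.pt := fun h' => hy (d.perm.injective (h'.trans h.symm))
      rw [out_directed_cons_of_ne hy, out_directed_cons_of_ne hy',
        out_directed_cons_of_ne (d := merge d d') hy]
      exact congrArg (_ :: ·) (DFunLike.congr_fun (perm_rooted_mul (d.sec y) (d'.sec (d.perm y))) v)

/-- The inverse of a directed automorphism. -/
def inv (d : DirectedAut Y) : DirectedAut Y where
  pt := d.perm d.pt
  perm := d.perm.symm
  sec y := (d.sec (d.perm.symm y)).symm

theorem automaton_isClosedUnderInversion : (automaton Y).IsClosedUnderInversion := by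
  rintro (d | f)
  · refine ⟨Sum.inl d.inv, eq_inv_of_mul_eq_one_left ?_⟩
    rw [perm_merge rfl]
    refine Equiv.ext fun v => ?_
    change (automaton Y).out _ v = v
    induction v with
    | nil => rfl
    | cons y v ih =>
      by_cases hy : y = d.pt
      · subst hy
        refine (out_directed_pt (merge d d.inv) v).trans ?_
        rw [ih]
        simp [merge, inv]
      · rw [out_directed_cons_of_ne (d := merge d d.inv) hy]
        have : (merge d d.inv).sec y = 1 := by
          ext
          simp [merge, inv]
        rw [this, out_rooted_one]
        simp [merge, inv]
  · refine ⟨Sum.inr f.symm, eq_inv_of_mul_eq_one_left ?_⟩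
    rw [perm_rooted_mul, Equiv.self_trans_symm]
    exact perm_rooted_one

/-! ### Normal forms -/

/-- A directed automorphism followed by a rooted one. -/
abbrev Syllable (Y : Type) : Type := DirectedAut Y × Equiv.Perm Y

/-- The word over the states that is given by a word of syllables. -/
def expand (u : List (Syllable Y)) : List (Letter Y) :=
  u.flatMap fun p => [Sum.inl p.1, Sum.inr p.2]

/-- The memory of the normalizing procedure: a rooted automorphism that comes before all the
syllables, and possibly the last syllable so far, together with the information whether there are
other syllables before it. -/
abbrev Pending (Y : Type) : Type := Equiv.Perm Y × Option (Syllable Y × Bool)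

open Classical in
/-- The memory after reading a letter. -/
noncomputable def feed : Pending Y → Letter Y → Pending Y
  | (f, none), Sum.inr g => (f.trans g, none)
  | (f, none), Sum.inl d => (f, some ((d, 1), false))
  | (f, some ((d, g), b)), Sum.inr g' => (f, some ((d, g.trans g'), b))
  | (f, some ((d, g), b)), Sum.inl d' => if g = 1 ∧ d.perm d.pt = d'.pt
      then (f, some ((merge d d', 1), b)) else (f, some ((d', 1), true))

open Classical in
/-- The syllables that are completed when a letter is read. -/
noncomputable def emit : Pending Y → Letter Y → List (Syllable Y)
  | (_, some ((d, g), _)), Sum.inl d' => if g = 1 ∧ d.perm d.pt = d'.pt then [] else [(d, g)]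
  | _, _ => []

/-- The memory after reading a word. -/
noncomputable def feeds : Pending Y → List (Letter Y) → Pending Y := List.foldl feed

/-- The syllables that are completed when a word is read. -/
noncomputable def emits : Pending Y → List (Letter Y) → List (Syllable Y)
  | _, [] => []
  | n, b :: w => emit n b ++ emits (feed n b) w

theorem feeds_append (n : Pending Y) (u w : List (Letter Y)) :
    feeds n (u ++ w) = feeds (feeds n u) w := List.foldl_append

theorem emits_append (n : Pending Y) (u w : List (Letter Y)) :
    emits n (u ++ w) = emits n u ++ emits (feeds n u) w := by
  induction u generalizing n with
  | nil => rfl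
  | cons b u ih =>
    rw [List.cons_append, emits, ih, emits, List.append_assoc]
    rfl

/-- The last syllable of the normal form, up to conjugation; it is omitted if it would be the only
one. -/
def lastSyllable : Pending Y → List (Syllable Y)
  | (f, some ((d, g), true)) => [(d, g.trans f)]
  | _ => []

/-- A word with at most one syllable represents the identity. -/
def IsGood : Pending Y → Prop
  | (f, none) => f = 1
  | (f, some ((d, g), false)) => (automaton Y).wordPerm (expand [(d, g.trans f)]) = 1
  | (_, some (_, true)) => True

/-- The word given by the pending syllable. -/
def pendingWord (n : Pending Y) : List (Letter Y) :=
  match n.2 with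
  | none => []
  | some (p, _) => expand [p]

/-- The memory is consistent with the syllables that have been completed. -/
def IsValid (n : Pending Y) (u : List (Syllable Y)) : Prop :=
  match n.2 with
  | none => u = []
  | some (_, b) => b = true ↔ u ≠ []

/-- The transformation represented by the completed syllables and the memory. -/
noncomputable def value (n : Pending Y) (u : List (Syllable Y)) : Equiv.Perm (List Y) :=
  (automaton Y).wordPerm (Sum.inr n.1 :: (expand u ++ pendingWord n))

theorem wordPerm_cons_letter (b : Letter Y) (w : List (Letter Y)) :
    (automaton Y).wordPerm (b :: w) = (automaton Y).wordPerm w * (automaton Y).perm b := rfl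

theorem wordPerm_nil : (automaton Y).wordPerm [] = 1 := rfl

theorem value_feed {n : Pending Y} {u : List (Syllable Y)} (h : IsValid n u) (b : Letter Y) :
    IsValid (feed n b) (u ++ emit n b) ∧
      value (feed n b) (u ++ emit n b) = (automaton Y).perm b * value n u := by
  obtain ⟨f, _ | ⟨⟨d, g⟩, m⟩⟩ := n <;> rcases b with d' | g'
  · have hu : u = [] := h
    subst hu
    refine ⟨by simp [IsValid, feed, emit], ?_⟩
    simp [value, feed, emit, expand, pendingWord, wordPerm_cons_letter, wordPerm_nil,
      perm_rooted_one]
  · have hu : u = [] := h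
    subst hu
    refine ⟨by simp [IsValid, feed, emit], ?_⟩
    simp [value, feed, emit, expand, pendingWord, wordPerm_cons_letter, wordPerm_nil,
      perm_rooted_mul]
  · by_cases hc : g = 1 ∧ d.perm d.pt = d'.pt
    · obtain ⟨rfl, hc⟩ := hc
      refine ⟨by simpa [IsValid, feed, emit, hc] using h, ?_⟩
      simp [value, feed, emit, expand, pendingWord, wordPerm_cons_letter, wordPerm_nil, hc,
        InvertibleAutomaton.wordPerm_append, perm_rooted_one, ← perm_merge hc, mul_assoc]
    · refine ⟨by simp [IsValid, feed, emit, hc], ?_⟩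
      simp [value, feed, emit, expand, pendingWord, wordPerm_cons_letter, wordPerm_nil, hc,
        InvertibleAutomaton.wordPerm_append, perm_rooted_one, mul_assoc]
  · refine ⟨by simpa [IsValid, feed, emit] using h, ?_⟩
    simp [value, feed, emit, expand, pendingWord, wordPerm_cons_letter, wordPerm_nil,
        InvertibleAutomaton.wordPerm_append, ← perm_rooted_mul, mul_assoc]

theorem value_feeds {n : Pending Y} {u : List (Syllable Y)} (h : IsValid n u)
    (w : List (Letter Y)) : IsValid (feeds n w) (u ++ emits n w) ∧
      value (feeds n w) (u ++ emits n w) = (automaton Y).wordPerm w * value n u := by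
  induction w generalizing n u with
  | nil => simpa [feeds, emits, wordPerm_nil] using h
  | cons b w ih =>
    have h1 := value_feed h b
    have h2 := ih h1.1
    rw [h1.2, List.append_assoc] at h2
    exact h2

/-- The normal form of a word, up to conjugation. -/
noncomputable def normalForm (w : List (Letter Y)) : List (Syllable Y) :=
  emits (1, none) w ++ lastSyllable (feeds (1, none) w)

theorem isValid_feeds (w : List (Letter Y)) :
    IsValid (feeds (1, none) w) (emits (1, none) w) :=
  (value_feeds (n := (1, none)) (u := []) rfl w).1

/-- Triviality is invariant under conjugation, so the leading rooted factor can be moved to the end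
and absorbed into the last syllable. If there is at most one syllable, the memory alone determines
the answer, and `IsGood` records it. -/
theorem wordPerm_eq_one_iff (w : List (Letter Y)) : (automaton Y).wordPerm w = 1 ↔
    IsGood (feeds (1, none) w) ∧ (automaton Y).wordPerm (expand (normalForm w)) = 1 := by
  have h := value_feeds (n := ((1, none) : Pending Y)) (u := []) rfl w
  have h1 : value ((1, none) : Pending Y) [] = 1 := perm_rooted_one
  rw [h1, mul_one, List.nil_append] at h
  rw [← h.2, normalForm]
  generalize feeds ((1, none) : Pending Y) w = n at h ⊢
  obtain ⟨f, _ | ⟨⟨d, g⟩, m⟩⟩ := n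
  · have hu : emits (1, none) w = [] := h.1
    rw [hu]
    have : (automaton Y).perm (Sum.inr f) = 1 ↔ f = 1 := by
      refine ⟨fun hf => Equiv.ext fun y => ?_, ?_⟩
      · have := DFunLike.congr_fun hf [y]
        change (automaton Y).out _ [y] = [y] at this
        simpa [out_rooted_cons] using this
      · rintro rfl
        exact perm_rooted_one
    simp [value, expand, pendingWord, lastSyllable, IsGood, wordPerm_cons_letter, wordPerm_nil,
      this]
  · have hconj : value (f, some ((d, g), m)) (emits (1, none) w) = 1 ↔
        (automaton Y).wordPerm (expand (emits (1, none) w ++ [(d, g.trans f)])) = 1 := by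
      rw [value, wordPerm_cons_letter, mul_eq_one_iff_eq_inv, eq_comm, inv_eq_iff_mul_eq_one]
      simp [expand, pendingWord, wordPerm_cons_letter, wordPerm_nil,
        InvertibleAutomaton.wordPerm_append, ← perm_rooted_mul, mul_assoc]
    rw [hconj]
    rcases m with _ | _
    · have hu : emits (1, none) w = [] := by
        have h2 : false = true ↔ emits (1, none) w ≠ [] := h.1
        simpa using h2
      rw [hu]
      simp only [IsGood, lastSyllable, List.nil_append]
      exact ⟨fun h => ⟨h, rfl⟩, fun h => h.1⟩
    · simp [IsGood, lastSyllable]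

/-- A directed automorphism is its own section at its special letter; words of one syllable could
recur forever and must not be passed on. -/
theorem length_normalForm_ne_one (w : List (Letter Y)) : (normalForm w).length ≠ 1 := by
  have h := isValid_feeds w
  rw [normalForm]
  generalize feeds ((1, none) : Pending Y) w = n at h ⊢
  obtain ⟨f, _ | ⟨⟨d, g⟩, m⟩⟩ := n
  · have hu : emits (1, none) w = [] := h
    simp [hu, lastSyllable]
  · have h : m = true ↔ emits (1, none) w ≠ [] := h
    rcases m with _ | _
    · have hu : emits (1, none) w = [] := by simpa using h
      simp [hu, lastSyllable]
    · have hu : emits (1, none) w ≠ [] := by simpa using h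
      simpa [lastSyllable] using hu

/-- The number of pending syllables. -/
def numPending (n : Pending Y) : ℕ := if n.2.isSome then 1 else 0

theorem length_emits_le (n : Pending Y) (w : List (Letter Y)) :
    (emits n w).length + numPending (feeds n w) ≤ w.countP Sum.isLeft + numPending n := by
  induction w generalizing n with
  | nil => simp [emits, feeds]
  | cons b w ih =>
    have h1 := ih (feed n b)
    have h2 : (emit n b).length + numPending (feed n b) ≤
        [b].countP Sum.isLeft + numPending n := by
      obtain ⟨f, _ | ⟨⟨d, g⟩, m⟩⟩ := n <;> rcases b with d' | g'
      · simp [emit, feed, numPending]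
      · simp [emit, feed, numPending]
      · by_cases hc : g = 1 ∧ d.perm d.pt = d'.pt <;> simp [emit, feed, numPending, hc]
      · simp [emit, feed, numPending]
    rw [emits, List.length_append, List.countP_cons]
    rw [List.countP_cons, List.countP_nil] at h2
    change _ + numPending (feeds (feed n b) w) ≤ _
    omega

theorem length_normalForm_le (w : List (Letter Y)) :
    (normalForm w).length ≤ w.countP Sum.isLeft := by
  have h1 := length_emits_le (1, none) w
  have h2 : (lastSyllable (feeds (1, none) w)).length ≤ numPending (feeds (1, none) w) := by
    obtain ⟨f, _ | ⟨⟨d, g⟩, _ | _⟩⟩ := feeds ((1, none) : Pending Y) w <;>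
      simp [lastSyllable, numPending]
  have h3 : numPending ((1, none) : Pending Y) = 0 := rfl
  rw [normalForm, List.length_append]
  omega

end DirectedAut

namespace DirectedAut

variable {Y : Type}

/-! ### Contraction -/

open Classical in
/-- The number of syllables whose directed automorphism survives in the section at `y`. -/
noncomputable def numHits : List (Syllable Y) → Y → ℕ
  | [], _ => 0
  | p :: u, y => (if y = p.1.pt then 1 else 0) + numHits u (p.2 (p.1.perm y))

/-- The special letter of the first syllable is mapped to that of the second one. -/
def IsLink (p q : Syllable Y) : Prop := p.2 (p.1.perm p.1.pt) = q.1.pt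

open Classical in
/-- The number of pairs of consecutive syllables that are linked. -/
noncomputable def numLinks : List (Syllable Y) → ℕ
  | [] => 0
  | [_] => 0
  | p :: q :: u => (if IsLink p q then 1 else 0) + numLinks (q :: u)

theorem numLinks_le (u : List (Syllable Y)) : numLinks u ≤ u.length := by
  induction u with
  | nil => simp [numLinks]
  | cons p u ih =>
    rcases u with _ | ⟨q, u⟩
    · simp [numLinks]
    · rw [numLinks, List.length_cons]
      split_ifs <;> omega

-- `IsLink` sees only the special letter of its second argument. Hence merging into the last
-- syllable, or changing its rooted part, creates no link.
open Classical in
theorem numLinks_append_singleton {p q : Syllable Y} (h : p.1.pt = q.1.pt)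
    (u : List (Syllable Y)) : numLinks (u ++ [p]) = numLinks (u ++ [q]) := by
  induction u with
  | nil => rfl
  | cons a u ih =>
    rcases u with _ | ⟨b, u⟩
    · have : IsLink a p ↔ IsLink a q := by simp [IsLink, h]
      simp only [List.nil_append, List.cons_append, numLinks]
      rw [if_congr this rfl rfl]
    · simp only [List.cons_append, numLinks] at ih ⊢
      rw [ih]

open Classical in
theorem numLinks_append_pair (p q : Syllable Y) (u : List (Syllable Y)) :
    numLinks (u ++ [p, q]) = numLinks (u ++ [p]) + if IsLink p q then 1 else 0 := by
  induction u with
  | nil => simp [numLinks]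
  | cons a u ih =>
    rcases u with _ | ⟨b, u⟩
    · simp [numLinks]
    · simp only [List.cons_append, numLinks] at ih ⊢
      rw [ih]
      omega

theorem section_expand_cons (p : Syllable Y) (u : List (Syllable Y)) (y : Y) :
    (automaton Y).wordSection (expand (p :: u)) y =
      [(automaton Y).t (Sum.inl p.1) y, Sum.inr 1] ++
        (automaton Y).wordSection (expand u) (p.2 (p.1.perm y)) := rfl

theorem countP_section_expand (u : List (Syllable Y)) (y : Y) :
    ((automaton Y).wordSection (expand u) y).countP Sum.isLeft = numHits u y := by
  induction u generalizing y with
  | nil => rfl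
  | cons p u ih =>
    rw [section_expand_cons, List.countP_append, ih, numHits]
    by_cases h : y = p.1.pt <;> simp [automaton, h, List.countP_cons]

/-- After a hit at `p` the current letter is the image of `p.1.pt`, so the next syllable is hit only
if the pair is linked. Every other hit is followed by a miss, except perhaps at the end; the second
clause drops the `+ 1` if the word begins with a miss. -/
theorem two_mul_numHits_le (u : List (Syllable Y)) (y : Y) :
    2 * numHits u y ≤ u.length + numLinks u + 1 ∧
      ∀ p v, u = p :: v → y ≠ p.1.pt → 2 * numHits u y ≤ u.length + numLinks u := by
  induction u generalizing y with
  | nil => simp [numHits]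
  | cons p u ih =>
    obtain ⟨ih1, ih2⟩ := ih (p.2 (p.1.perm y))
    by_cases hy : y = p.1.pt
    · refine ⟨?_, fun q v h => ?_⟩
      · rw [numHits, if_pos hy]
        rcases u with _ | ⟨q, u⟩
        · simp [numHits, numLinks]
        · rw [numLinks, List.length_cons]
          by_cases hl : IsLink p q
          · rw [if_pos hl]
            omega
          · have := ih2 q u rfl (by rw [hy]; exact hl)
            rw [if_neg hl]
            omega
      · obtain ⟨rfl, rfl⟩ := List.cons_eq_cons.1 h
        exact fun h' => absurd hy h'
    · have : 2 * numHits (p :: u) y ≤ (p :: u).length + numLinks (p :: u) := by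
        rw [numHits, if_neg hy]
        have : numLinks u ≤ numLinks (p :: u) := by
          rcases u with _ | ⟨q, u⟩
          · simp [numLinks]
          · rw [numLinks.eq_3]
            omega
        rw [List.length_cons]
        omega
      exact ⟨by omega, fun _ _ _ _ => this⟩

/-- Each directed automorphism survives in the section at exactly one letter. -/
theorem sum_numHits [Fintype Y] (u : List (Syllable Y)) : ∑ y, numHits u y = u.length := by
  induction u with
  | nil => simp [numHits]
  | cons p u ih =>
    classical
    simp only [numHits, Finset.sum_add_distrib]
    have := (p.1.perm.trans p.2).sum_comp fun y => numHits u y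
    simp only [Equiv.trans_apply] at this
    rw [this, ih]
    simp [Nat.add_comm]

open Classical in
/-- The length of the list of all the syllables so far, plus the number of links, plus a correction
that depends on the last syllable. -/
noncomputable def weight (n : Pending Y) (u : List (Syllable Y)) : ℕ :=
  match n.2 with
  | none => 0
  | some (p, _) => u.length + 1 + numLinks (u ++ [p]) + if p.2 = 1 then 0 else 1

/-- A new syllable uses up one letter. If it is linked to the preceding one, that one has a
nontrivial rooted part, because otherwise the two would have been merged; the rooted part took
another letter, counted in advance by the correction term of `weight`. -/
theorem weight_feed {n : Pending Y} {u : List (Syllable Y)} (h : IsValid n u) (b : Letter Y) :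
    weight (feeds n [b, Sum.inr 1]) (u ++ emits n [b, Sum.inr 1]) ≤ weight n u + 1 := by
  have h1 : emits n [b, Sum.inr 1] = emit n b := by
    have : emit (feed n b) (Sum.inr 1) = [] := by
      obtain ⟨f, _ | ⟨⟨d, g⟩, m⟩⟩ := feed n b <;> rfl
    simp [emits, this]
  have h2 : feeds n [b, Sum.inr 1] = feed (feed n b) (Sum.inr 1) := rfl
  have h3 : feed (feed n b) (Sum.inr 1) = feed n b := by
    obtain ⟨f, _ | ⟨⟨d, g⟩, m⟩⟩ := feed n b <;> rfl
  rw [h1, h2, h3]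
  obtain ⟨f, _ | ⟨⟨d, g⟩, m⟩⟩ := n <;> rcases b with d' | g'
  · have hu : u = [] := h
    simp [hu, weight, feed, emit, numLinks]
  · simp [weight, feed]
  · by_cases hc : g = 1 ∧ d.perm d.pt = d'.pt
    · simp only [weight, feed, emit, hc, and_self, if_true, List.append_nil]
      rw [numLinks_append_singleton (p := (merge d d', 1)) (q := (d, g)) rfl]
      simp [hc.1]
    · simp only [weight, feed, emit, hc, if_false, if_true, List.append_assoc, List.length_append,
        List.cons_append, List.nil_append, numLinks_append_pair, List.length_singleton]
      -- For `g = 1` the failure of merging rules out a link; for `g ≠ 1` a link is paid for by the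
      -- correction term, which the new last syllable, with rooted part `1`, does not need.
      by_cases hg : g = 1
      · have hl : ¬ IsLink (d, g) (d', 1) := fun hl => hc ⟨hg, by simpa [IsLink, hg] using hl⟩
        simp only [hl, if_false]
        omega
      · simp only [hg, if_false]
        split_ifs <;> omega
  · simp only [weight, feed, emit, List.append_nil]
    rw [numLinks_append_singleton (p := (d, g.trans g')) (q := (d, g)) rfl]
    split_ifs <;> omega

theorem weight_feeds {n : Pending Y} {v : List (Syllable Y)} (h : IsValid n v)
    (u : List (Syllable Y)) (y : Y) :
    weight (feeds n ((automaton Y).wordSection (expand u) y))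
      (v ++ emits n ((automaton Y).wordSection (expand u) y)) ≤ weight n v + u.length := by
  induction u generalizing n v y with
  | nil =>
    have : (automaton Y).wordSection (expand []) y = [] := rfl
    simp [this, feeds, emits]
  | cons p u ih =>
    rw [section_expand_cons, feeds_append, emits_append, ← List.append_assoc]
    have h1 := weight_feed h ((automaton Y).t (Sum.inl p.1) y)
    have h2 := ih (value_feeds h [(automaton Y).t (Sum.inl p.1) y, Sum.inr 1]).1
      (p.2 (p.1.perm y))
    rw [List.length_cons]
    omega

/-- The normal form of the section at `y`. -/
noncomputable def sectionForm (u : List (Syllable Y)) (y : Y) : List (Syllable Y) :=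
  normalForm ((automaton Y).wordSection (expand u) y)

/-- The weight starts at 0 and grows by at most one per syllable of `u`; the final conjugation
changes only the rooted part of the last syllable, hence no link. -/
theorem length_sectionForm_add_numLinks_le (u : List (Syllable Y)) (y : Y) :
    (sectionForm u y).length + numLinks (sectionForm u y) ≤ u.length := by
  have h1 := weight_feeds (n := (1, none)) (v := []) rfl u y
  have h2 := isValid_feeds ((automaton Y).wordSection (expand u) y)
  rw [sectionForm, normalForm]
  rw [List.nil_append] at h1
  generalize feeds ((1, none) : Pending Y) ((automaton Y).wordSection (expand u) y) = n at h1 h2 ⊢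
  generalize emits ((1, none) : Pending Y) ((automaton Y).wordSection (expand u) y) = v at h1 h2 ⊢
  have h0 : weight ((1, none) : Pending Y) [] = 0 := rfl
  obtain ⟨f, _ | ⟨⟨d, g⟩, m⟩⟩ := n
  · have hv : v = [] := h2
    simp [hv, lastSyllable, numLinks]
  · have h2 : m = true ↔ v ≠ [] := h2
    rcases m with _ | _
    · have hv : v = [] := by simpa using h2
      simp [hv, lastSyllable, numLinks]
    · simp only [weight] at h1
      rw [lastSyllable, numLinks_append_singleton (p := (d, g.trans f)) (q := (d, g)) rfl,
        List.length_append, List.length_singleton]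
      omega

theorem length_sectionForm_le_numHits (u : List (Syllable Y)) (y : Y) :
    (sectionForm u y).length ≤ numHits u y := by
  rw [← countP_section_expand]
  exact length_normalForm_le _

/-- A bound for the depth of the tree of all the iterated sections. -/
noncomputable def depth (u : List (Syllable Y)) : ℕ :=
  Nat.clog 2 u.length + Nat.clog 2 (u.length + numLinks u) + 1

/-- The two logarithms in `depth` change roles: length plus links of the section is at most the
length of `u`, and the length of the section is at most half of length plus links of `u`, rounded
up. -/
theorem depth_sectionForm_lt (u : List (Syllable Y)) (y : Y) (h : sectionForm u y ≠ []) :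
    depth (sectionForm u y) + 1 ≤ depth u := by
  have h1 := length_sectionForm_add_numLinks_le u y
  have h2 := (two_mul_numHits_le u y).1
  have h3 := length_sectionForm_le_numHits u y
  have h4 : (sectionForm u y).length ≠ 1 := length_normalForm_ne_one _
  have h5 := List.length_pos_iff.2 h
  -- Needs an argument of at least 2: the section form is nonempty and does not have length 1, and
  -- `h1` carries this over to `u`.
  have h6 : Nat.clog 2 (u.length + numLinks u) =
      Nat.clog 2 ((u.length + numLinks u + 2 - 1) / 2) + 1 :=
    Nat.clog_of_two_le (by norm_num) (by omega)
  have h7 : Nat.clog 2 (sectionForm u y).length ≤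
      Nat.clog 2 ((u.length + numLinks u + 2 - 1) / 2) := Nat.clog_mono_right 2 (by omega)
  have h8 := Nat.clog_mono_right 2 h1
  rw [depth, depth]
  omega

/-- A bound for the total length of all the iterated sections. -/
noncomputable def cost (u : List (Syllable Y)) : ℕ := 2 * depth u * u.length

/-- The children have at most `u.length` syllables in total and smaller depth, which leaves `2 *
u.length` for `u` itself. -/
theorem sum_cost_le [Fintype Y] (u : List (Syllable Y)) (hu : u ≠ []) :
    u.length + 1 + ∑ y, cost (sectionForm u y) ≤ cost u := by
  have h1 : ∀ y, cost (sectionForm u y) ≤ 2 * (depth u - 1) * numHits u y := fun y => by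
    rcases eq_or_ne (sectionForm u y) [] with h | h
    · simp [cost, h]
    · have := depth_sectionForm_lt u y h
      exact Nat.mul_le_mul (by omega) (length_sectionForm_le_numHits u y)
  have h2 := Finset.sum_le_sum fun y (_ : y ∈ Finset.univ) => h1 y
  rw [← Finset.mul_sum, sum_numHits] at h2
  have h3 := List.length_pos_iff.2 hu
  obtain ⟨D, hD⟩ : ∃ D, depth u = D + 1 := ⟨_, rfl⟩
  rw [cost, hD]
  rw [hD, Nat.add_sub_cancel] at h2
  nlinarith

theorem cost_le (u : List (Syllable Y)) {m : ℕ} (hu : u.length ≤ m) :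
    cost u ≤ 2 * (2 * Nat.clog 2 (2 * m) + 1) * m := by
  refine Nat.mul_le_mul (Nat.mul_le_mul_left 2 ?_) hu
  have h1 : Nat.clog 2 u.length ≤ Nat.clog 2 (2 * m) := Nat.clog_mono_right 2 (by omega)
  have h2 : Nat.clog 2 (u.length + numLinks u) ≤ Nat.clog 2 (2 * m) :=
    Nat.clog_mono_right 2 (by have := numLinks_le u; omega)
  rw [depth]
  omega

/-! ### The transducer that computes normal forms of sections -/

section

variable {σ : Type} (og : σ → Equiv.Perm Y) (sg : σ → Y → List (Letter Y)) {d : ℕ}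
  (en : Fin d ≃ Y)

/-- The permutation of the alphabet that is defined by an input letter or by a syllable. -/
noncomputable def inputOut : σ ⊕ Syllable Y → Equiv.Perm Y :=
  Sum.elim og fun p => (automaton Y).wordOut [Sum.inl p.1, Sum.inr p.2]

/-- The section of an input letter or of a syllable. -/
noncomputable def inputSection : σ ⊕ Syllable Y → Y → List (Letter Y) :=
  Sum.elim sg fun p => (automaton Y).wordSection [Sum.inl p.1, Sum.inr p.2]

/-- The permutation of the alphabet that is defined by a word of input letters and syllables. -/
noncomputable def inputWordOut : List (σ ⊕ Syllable Y) → Equiv.Perm Y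
  | [] => 1
  | l :: w => (inputOut og l).trans (inputWordOut w)

/-- The section of a word of input letters and syllables. -/
noncomputable def inputWordSection : List (σ ⊕ Syllable Y) → Y → List (Letter Y)
  | [], _ => []
  | l :: w, y => inputSection sg l y ++ inputWordSection w (inputOut og l y)

variable {og sg}

theorem inputWordOut_map_inr (u : List (Syllable Y)) :
    inputWordOut og (u.map Sum.inr) = (automaton Y).wordOut (expand u) := by
  induction u with
  | nil => rfl
  | cons p u ih =>
    rw [List.map_cons, inputWordOut, ih]
    rfl

theorem inputWordSection_map_inr (u : List (Syllable Y)) (y : Y) :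
    inputWordSection og sg (u.map Sum.inr) y = (automaton Y).wordSection (expand u) y := by
  induction u generalizing y with
  | nil => rfl
  | cons p u ih =>
    rw [List.map_cons, inputWordSection, ih]
    rfl

theorem length_inputWordSection_le {τ : Type*} (e : τ → σ) {E : ℕ} (hE : ∀ a y, (sg a y).length ≤ E)
    (w : List τ) (y : Y) :
    (inputWordSection og sg (w.map fun a => Sum.inl (e a)) y).length ≤ E * w.length := by
  induction w generalizing y with
  | nil => simp [inputWordSection]
  | cons a w ih =>
    rw [List.map_cons, inputWordSection, List.length_append, List.length_cons, Nat.mul_add]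
    have h1 := ih (inputOut og (Sum.inl (e a)) y)
    have h2 : (inputSection sg (Sum.inl (e a)) y).length ≤ E := hE _ _
    omega

variable (og sg) in
/-- A word of input letters and syllables represents the identity. -/
def IsTrivialWord (w : List (σ ⊕ Syllable Y)) : Prop :=
  inputWordOut og w = 1 ∧ ∀ y, (automaton Y).wordPerm (inputWordSection og sg w y) = 1

theorem isTrivialWord_map_inr (u : List (Syllable Y)) :
    IsTrivialWord og sg (u.map Sum.inr) ↔ (automaton Y).wordPerm (expand u) = 1 := by
  rw [IsTrivialWord, InvertibleAutomaton.wordPerm_eq_one_iff, inputWordOut_map_inr]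
  simp only [inputWordSection_map_inr]

variable [Finite Y] (og sg)

/-- The transducer that computes normal forms of sections. It remembers the permutation of the
alphabet that is defined by what has been read, and the memory of the normalizing procedure for
every section. -/
noncomputable def sectionTransducer : Transducer (σ ⊕ Syllable Y) (Syllable Y) d where
  Q := Equiv.Perm Y × (Y → Pending Y)
  finiteQ := inferInstance
  init := (1, fun _ => (1, none))
  next q l := (q.1.trans (inputOut og l), fun y => feeds (q.2 y) (inputSection sg l (q.1 y)))
  write q l i := emits (q.2 (en i)) (inputSection sg l (q.1 (en i)))
  accept q := q.1 = 1 ∧ ∀ y, IsGood (q.2 y)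
  last q i := lastSyllable (q.2 (en i))

variable {og sg en}

theorem run_sectionTransducer (w : List (σ ⊕ Syllable Y)) (q : Equiv.Perm Y × (Y → Pending Y)) :
    (sectionTransducer og sg en).run q w = (q.1.trans (inputWordOut og w),
      fun y => feeds (q.2 y) (inputWordSection og sg w (q.1 y))) := by
  induction w generalizing q with
  | nil => rfl
  | cons l w ih =>
    refine (ih _).trans ?_
    simp only [inputWordSection, feeds_append]
    rfl

theorem output_sectionTransducer (w : List (σ ⊕ Syllable Y)) (q : Equiv.Perm Y × (Y → Pending Y))
    (i : Fin d) : (sectionTransducer og sg en).output q w i =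
      emits (q.2 (en i)) (inputWordSection og sg w (q.1 (en i))) ++
      lastSyllable (feeds (q.2 (en i)) (inputWordSection og sg w (q.1 (en i)))) := by
  induction w generalizing q with
  | nil => rfl
  | cons l w ih =>
    refine (congrArg (_ ++ ·) (ih _)).trans ?_
    simp only [inputWordSection, feeds_append, emits_append, List.append_assoc]
    rfl

theorem child_sectionTransducer (w : List (σ ⊕ Syllable Y)) (i : Fin d) :
    (sectionTransducer og sg en).child w i = normalForm (inputWordSection og sg w (en i)) :=
  output_sectionTransducer w _ i

theorem isTrivialWord_iff (w : List (σ ⊕ Syllable Y)) : IsTrivialWord og sg w ↔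
    (sectionTransducer og sg en).Accepts w ∧
      ∀ i, IsTrivialWord og sg (((sectionTransducer og sg en).child w i).map Sum.inr) := by
  have h : (sectionTransducer og sg en).Accepts w ↔
      (inputWordOut og w = 1 ∧ ∀ y, IsGood (feeds (1, none) (inputWordSection og sg w y))) := by
    rw [Transducer.Accepts]
    refine (iff_of_eq (congrArg _ (run_sectionTransducer w _))).trans ?_
    rfl
  rw [h, IsTrivialWord]
  simp only [isTrivialWord_map_inr, child_sectionTransducer]
  rw [en.forall_congr_right (q := fun y =>
    (automaton Y).wordPerm (expand (normalForm (inputWordSection og sg w y))) = 1)]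
  rw [and_assoc, ← forall_and]
  simp only [← wordPerm_eq_one_iff]

variable (og sg) in
theorem exists_decidesInTime [Finite σ] {τ : Type*} (e : τ ↪ σ) :
    ∃ (M : MultiTapeTM τ) (C D E : ℕ),
      M.DecidesInTime {w | IsTrivialWord og sg (w.map fun a => Sum.inl (e a))}
        fun n => C * (n + 1 + D * (2 * (2 * Nat.clog 2 (2 * (E * n)) + 1) * (E * n))) := by
  have := Fintype.ofFinite Y
  obtain ⟨E, hE⟩ : ∃ E, ∀ a y, (sg a y).length ≤ E := by
    obtain ⟨E, hE⟩ := (Set.finite_range fun p : σ × Y => (sg p.1 p.2).length).bddAbove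
    exact ⟨E, fun a y => hE ⟨(a, y), rfl⟩⟩
  let en : Fin (Fintype.card Y) ≃ Y := (Fintype.equivFin Y).symm
  obtain ⟨M, C, hM⟩ := (sectionTransducer og sg en).exists_decidesInTime e (IsTrivialWord og sg)
    cost ⟨rfl, fun _ => rfl⟩ (fun w _ => isTrivialWord_iff w)
    (fun u hu => by
      simp only [child_sectionTransducer, inputWordSection_map_inr]
      rw [en.sum_comp fun y => cost (normalForm ((automaton Y).wordSection (expand u) y))]
      exact sum_cost_le u hu)
    (fun n => Fintype.card Y * (2 * (2 * Nat.clog 2 (2 * (E * n)) + 1) * (E * n)))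
    (fun w => by
      refine (Finset.sum_le_card_nsmul _ _
        (2 * (2 * Nat.clog 2 (2 * (E * w.length)) + 1) * (E * w.length)) fun i _ => ?_).trans
        (by simp)
      rw [child_sectionTransducer]
      refine cost_le _ ((length_normalForm_le _).trans (List.countP_le_length.trans ?_))
      exact length_inputWordSection_le e hE w (en i))
  exact ⟨M, C, Fintype.card Y, E, hM⟩

end

end DirectedAut

/-! ### Comparison of the explicit time bound with `n log n` -/

theorem isBigO_mul_clog (C D E : ℕ) :
    (fun n : ℕ => ((C * (n + 1 + D * (2 * (2 * Nat.clog 2 (2 * (E * n)) + 1) * (E * n))) : ℕ) : ℝ))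
      =O[atTop] fun n : ℕ => (n : ℝ) * Real.log n := by
  -- From `log (2E) ≤ 2E - 1` and `1 ≤ log n`, the predecessor of the `clog` is at most `(2E + 1) /
  -- log 2 * log n`; the summand 1 in `K` makes up for the predecessor.
  set K : ℝ := (2 * E + 1) / Real.log 2 + 1 with hK
  have hlog2 : 0 < Real.log 2 := Real.log_pos (by norm_num)
  refine IsBigO.of_bound (C * (2 + D * (2 * (2 * K + 1) * E))) ?_
  filter_upwards [eventually_ge_atTop 3] with n hn
  have hn' : (3 : ℝ) ≤ n := by exact_mod_cast hn
  have hlog : 1 ≤ Real.log n := by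
    rw [Real.le_log_iff_exp_le (by linarith)]
    exact (Real.exp_one_lt_d9.le.trans (by norm_num)).trans hn'
  have hc : (Nat.clog 2 (2 * (E * n)) : ℝ) ≤ K * Real.log n := by
    rcases le_or_gt (2 * (E * n)) 1 with h | h
    · rw [Nat.clog_of_right_le_one h]
      have : 0 ≤ K := by positivity
      rw [Nat.cast_zero]
      exact mul_nonneg this (by linarith)
    · have h1 := Nat.pow_pred_clog_lt_self (b := 2) (by norm_num) h
      have h2 : ((2 : ℝ) ^ (Nat.clog 2 (2 * (E * n))).pred) ≤ 2 * E * n := by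
        rw [mul_assoc]
        exact_mod_cast h1.le
      have h3 := Real.log_le_log (by positivity) h2
      have hE : (0 : ℝ) < 2 * E := by
        have : E ≠ 0 := by
          rintro rfl
          simp at h
        positivity
      rw [Real.log_pow, Real.log_mul hE.ne' (by linarith)] at h3
      have h4 := Real.log_le_sub_one_of_pos hE
      have h5 : (Nat.clog 2 (2 * (E * n)) : ℝ) ≤ (Nat.clog 2 (2 * (E * n))).pred + 1 := by
        have : Nat.clog 2 (2 * (E * n)) ≤ (Nat.clog 2 (2 * (E * n))).pred + 1 := by
          rw [Nat.pred_eq_sub_one]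
          omega
        exact_mod_cast this
      have h6 : ((Nat.clog 2 (2 * (E * n))).pred : ℝ) ≤ (2 * E + 1) / Real.log 2 * Real.log n := by
        rw [div_mul_eq_mul_div, le_div_iff₀ hlog2]
        nlinarith
      rw [hK]
      linarith
  rw [Real.norm_of_nonneg (by positivity), Real.norm_of_nonneg (by positivity)]
  push_cast
  calc (C : ℝ) * (n + 1 + D * (2 * (2 * Nat.clog 2 (2 * (E * n)) + 1) * (E * n)))
      ≤ C * (n * Real.log n + n * Real.log n +
          D * (2 * (2 * (K * Real.log n) + Real.log n) * (E * n))) := by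
        gcongr
        · nlinarith
        · nlinarith
    _ = C * (2 + D * (2 * (2 * K + 1) * E)) * (n * Real.log n) := by ring

/-! ### The structure of bounded automata -/

namespace InvertibleAutomaton

variable {S X : Type} (A : InvertibleAutomaton S X)

theorem stateSection_append (s : S) (u v : List X) :
    A.stateSection s (u ++ v) = A.stateSection (A.stateSection s u) v := List.foldl_append

theorem out_append (s : S) (u v : List X) :
    A.out s (u ++ v) = A.out s u ++ A.out (A.stateSection s u) v := by
  induction u generalizing s with
  | nil => rfl
  | cons x u ih => exact congrArg (A.o s x :: ·) (ih _)

theorem length_out (s : S) (u : List X) : (A.out s u).length = u.length := by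
  induction u generalizing s with
  | nil => rfl
  | cons x u ih => exact congrArg (· + 1) (ih _)

/-! ### Active states -/

variable {A}

theorem IsTrivialState.out_eq {s : S} (h : A.IsTrivialState s) (u : List X) : A.out s u = u :=
  DFunLike.congr_fun h u

theorem IsTrivialState.stateSection {s : S} (h : A.IsTrivialState s) (u : List X) :
    A.IsTrivialState (A.stateSection s u) := by
  refine Equiv.ext fun v => ?_
  have := h.out_eq (u ++ v)
  rw [out_append, h.out_eq] at this
  exact List.append_cancel_left this

variable (A) in
/-- All the sections of `s` at words of length `n` are trivial. -/
def IsTrivialBelow (s : S) (n : ℕ) : Prop :=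
  ∀ v : List X, v.length = n → A.IsTrivialState (A.stateSection s v)

theorem IsTrivialBelow.mono {s : S} {m n : ℕ} (h : A.IsTrivialBelow s m) (hmn : m ≤ n) :
    A.IsTrivialBelow s n := fun v hv => by
  rw [← List.take_append_drop m v, stateSection_append]
  exact (h _ (by rw [List.length_take]; omega)).stateSection _

variable (A) in
/-- The state `s` has nontrivial sections on all levels. -/
def IsActive (s : S) : Prop := ∀ n, ¬ A.IsTrivialBelow s n

theorem IsActive.of_stateSection {s : S} {u : List X} (h : A.IsActive (A.stateSection s u)) :
    A.IsActive s := fun n hn => h n fun v hv => by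
  rw [← stateSection_append, ← List.take_append_drop n (u ++ v), stateSection_append]
  exact (hn _ (by rw [List.length_take, List.length_append]; omega)).stateSection _

theorem IsActive.exists_letter [Finite X] {s : S} (h : A.IsActive s) :
    ∃ x, A.IsActive (A.t s x) := by
  by_contra! hx
  simp only [IsActive, not_forall, not_not] at hx
  choose n hn using hx
  obtain ⟨N, hN⟩ := (Set.finite_range n).bddAbove
  refine h (N + 1) fun v hv => ?_
  obtain ⟨x, v, rfl⟩ := List.exists_cons_of_length_eq_add_one hv
  exact (hn x).mono (hN ⟨x, rfl⟩) v (by simpa using hv)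

open Classical in
variable (A) in
/-- An active section of an active state at a letter. -/
noncomputable def activeSection (s : S) : S :=
  if h : ∃ x, A.IsActive (A.t s x) then A.t s h.choose else s

theorem IsActive.exists_word [Finite X] {s : S} (h : A.IsActive s) (n : ℕ) :
    ∃ u : List X, u.length = n ∧ A.stateSection s u = A.activeSection^[n] s ∧
      A.IsActive (A.stateSection s u) := by
  induction n generalizing s with
  | zero => exact ⟨[], rfl, rfl, h⟩
  | succ n ih =>
    have hx := h.exists_letter
    have ht : A.activeSection s = A.t s hx.choose := dif_pos hx
    obtain ⟨u, hu1, hu2, hu3⟩ := ih hx.choose_spec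
    refine ⟨hx.choose :: u, by simpa using hu1, ?_, hu3⟩
    rw [Function.iterate_succ_apply, ht]
    exact hu2

variable (A) in
/-- The words of length `n` at which `s` has active sections. -/
def activeWords (s : S) (n : ℕ) : Set (List X) :=
  {v | v.length = n ∧ A.IsActive (A.stateSection s v)}

theorem finite_activeWords [Finite X] (s : S) (n : ℕ) : (A.activeWords s n).Finite :=
  (List.finite_length_eq X n).subset fun _ hv => hv.1

/-- Every active word has an active extension by `n` letters, which injects one level into the
other; a second extension of the same word lies outside the image. -/
theorem ncard_activeWords_add_le [Finite X] (s : S) (m n : ℕ) :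
    (A.activeWords s m).ncard ≤ (A.activeWords s (m + n)).ncard ∧
    ∀ v ∈ A.activeWords s m, ∀ u ∈ A.activeWords (A.stateSection s v) n,
      ∀ u' ∈ A.activeWords (A.stateSection s v) n, u ≠ u' →
      (A.activeWords s m).ncard < (A.activeWords s (m + n)).ncard := by
  have hext : ∀ v ∈ A.activeWords s m, ∃ u, u ∈ A.activeWords (A.stateSection s v) n :=
    fun v hv => (hv.2.exists_word n).imp fun u hu => ⟨hu.1, hu.2.2⟩
  choose! ext hext using hext
  have hmem : ∀ v ∈ A.activeWords s m, ∀ u ∈ A.activeWords (A.stateSection s v) n,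
      v ++ u ∈ A.activeWords s (m + n) := fun v hv u hu =>
    ⟨by rw [List.length_append, hv.1, hu.1], by rw [stateSection_append]; exact hu.2⟩
  have hsub : (fun v => v ++ ext v) '' A.activeWords s m ⊆ A.activeWords s (m + n) := by
    rintro _ ⟨v, hv, rfl⟩
    exact hmem v hv _ (hext v hv)
  have hinj : Set.InjOn (fun v => v ++ ext v) (A.activeWords s m) := fun v hv w hw h =>
    (List.append_inj h (hv.1.trans hw.1.symm)).1
  rw [← hinj.ncard_image]
  refine ⟨Set.ncard_le_ncard hsub (finite_activeWords s _), fun v hv u hu u' hu' hne => ?_⟩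
  obtain ⟨z, hz, hzne⟩ : ∃ z ∈ A.activeWords (A.stateSection s v) n, z ≠ ext v := by
    by_cases h : u = ext v
    · exact ⟨u', hu', fun h' => hne (h.trans h'.symm)⟩
    · exact ⟨u, hu, h⟩
  refine Set.ncard_lt_ncard ((Set.ssubset_iff_of_subset hsub).2
    ⟨v ++ z, hmem v hv z hz, ?_⟩) (finite_activeWords s _)
  rintro ⟨w, hw, h⟩
  obtain ⟨rfl, h2⟩ := List.append_inj h (hw.1.trans hv.1.symm)
  exact hzne h2.symm

/-- Deep active sections have at most one active section on every level. -/
theorem IsBounded.exists_unique_active [Finite S] [Finite X] (hA : A.IsBounded) :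
    ∃ N, ∀ s v, N ≤ v.length → ∀ u u' : List X, u.length = u'.length →
      A.IsActive (A.stateSection (A.stateSection s v) u) →
      A.IsActive (A.stateSection (A.stateSection s v) u') → u = u' := by
  obtain ⟨C, hC⟩ := hA
  have hbound : ∀ s n, (A.activeWords s n).ncard ≤ C := fun s n =>
    (Set.ncard_le_ncard (fun v hv => (⟨hv.1, fun h => hv.2 0 fun u hu => by
      rw [List.length_eq_zero_iff.1 hu]
      exact h⟩ : _ ∧ _)) ((List.finite_length_eq X n).subset fun _ hv => hv.1)).trans (hC s n)
  -- The number of active words is monotone in the level and bounded by `C`. Beyond a level where it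
  -- is maximal, no active word can branch.
  have hmax : ∀ s, ∃ n, ∀ m, (A.activeWords s m).ncard ≤ (A.activeWords s n).ncard := fun s => by
    have hbdd : BddAbove (Set.range fun n => (A.activeWords s n).ncard) :=
      ⟨C, by rintro _ ⟨n, rfl⟩; exact hbound s n⟩
    obtain ⟨n, hn⟩ := Nat.sSup_mem (Set.range_nonempty _) hbdd
    exact ⟨n, fun m => (le_csSup hbdd ⟨m, rfl⟩).trans hn.ge⟩
  choose n hn using hmax
  obtain ⟨N, hN⟩ := (Set.finite_range n).bddAbove
  refine ⟨N, fun s v hv u u' hlen hu hu' => ?_⟩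
  by_contra hne
  have h1 : n s ≤ v.length := (hN ⟨s, rfl⟩).trans hv
  have h2 := (ncard_activeWords_add_le (A := A) s (n s) (v.length - n s)).1
  rw [Nat.add_sub_cancel' h1] at h2
  have h3 := (ncard_activeWords_add_le (A := A) s v.length u.length).2 v
    ⟨rfl, hu.of_stateSection⟩ u ⟨rfl, hu⟩ u' ⟨hlen.symm, hu'⟩ hne
  exact absurd (hn s (v.length + u.length)) (by omega)

theorem exists_depth [Finite S] : ∃ D, ∀ s, ¬ A.IsActive s → A.IsTrivialBelow s D := by
  have h : ∀ s, ∃ n, ¬ A.IsActive s → A.IsTrivialBelow s n := fun s => by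
    by_cases hs : A.IsActive s
    · exact ⟨0, fun h => absurd hs h⟩
    · simp only [IsActive, not_forall, not_not] at hs
      exact hs.imp fun n hn _ => hn
  choose n hn using h
  obtain ⟨D, hD⟩ := (Set.finite_range n).bddAbove
  exact ⟨D, fun s hs => (hn s hs).mono (hD ⟨s, rfl⟩)⟩

end InvertibleAutomaton

/-- The iterates of `f` are eventually periodic; a multiple of the period beyond the preperiod gives
an idempotent. -/
theorem Function.exists_iterate_idempotent {S : Type*} [Finite S] (f : S → S) (N : ℕ) :
    ∃ p, N < p ∧ f^[p + p] = f^[p] := by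
  obtain ⟨i, j, hij, h⟩ := Finite.exists_ne_map_eq_of_infinite fun n : ℕ => f^[n]
  wlog hlt : i < j generalizing i j
  · exact this j i hij.symm h.symm (by omega)
  have h1 : ∀ n, i ≤ n → f^[n + (j - i)] = f^[n] := fun n hn => by
    obtain ⟨m, rfl⟩ := Nat.exists_eq_add_of_le hn
    have : i + m + (j - i) = m + j := by omega
    rw [this, Nat.add_comm i m, Function.iterate_add, Function.iterate_add]
    exact congrArg (f^[m] ∘ ·) h.symm
  have h2 : ∀ k n, i ≤ n → f^[n + k * (j - i)] = f^[n] := fun k n hn => by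
    induction k with
    | zero => simp
    | succ k ih =>
      rw [Nat.succ_mul, ← Nat.add_assoc, h1 _ (by omega), ih]
  have h3 : i + N + 1 ≤ (i + N + 1) * (j - i) := Nat.le_mul_of_pos_right _ (by omega)
  exact ⟨(i + N + 1) * (j - i), by omega, h2 _ _ (by omega)⟩

namespace InvertibleAutomaton

variable {S X : Type} {A : InvertibleAutomaton S X}

/-- On a suitable level, every section of a bounded automaton is either trivial below this level, or
it is its own section at one word, and its other sections are trivial below this level. -/
theorem IsBounded.exists_level [Finite S] [Finite X] (hA : A.IsBounded) :
    ∃ M, 0 < M ∧ ∀ (s : S) (v : List X), v.length = M →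
      A.IsTrivialBelow (A.stateSection s v) M ∨
      ∃ u : List X, u.length = M ∧
        A.stateSection (A.stateSection s v) u = A.stateSection s v ∧
        ∀ z : List X, z.length = M → z ≠ u →
          A.IsTrivialBelow (A.stateSection (A.stateSection s v) z) M := by
  obtain ⟨N, hN⟩ := hA.exists_unique_active
  obtain ⟨D, hD⟩ := exists_depth (A := A)
  obtain ⟨p, hp, hpp⟩ := Function.exists_iterate_idempotent A.activeSection (N + D)
  -- The first `p` letters of `v` lead beyond the level `N` where active words stop branching. The
  -- other `p` are then forced, so an active section at `v` lies in the image of the idempotent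
  -- `A.activeSection^[p]` and is fixed by it.
  refine ⟨p + p, by omega, fun s v hv => ?_⟩
  by_cases hact : A.IsActive (A.stateSection s v)
  · right
    obtain ⟨u, hu1, hu2, hu3⟩ := hact.exists_word (p + p)
    refine ⟨u, hu1, ?_, fun z hz hzu => (hD _ fun hz' => ?_).mono (by omega)⟩
    · have hv' : A.stateSection s v =
          A.stateSection (A.stateSection s (v.take p)) (v.drop p) := by
        rw [← stateSection_append, List.take_append_drop]
      rw [hu2, hpp, hv']
      rw [hv'] at hact
      obtain ⟨z, hz1, hz2, hz3⟩ := hact.of_stateSection.exists_word p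
      have := hN s (v.take p) (by rw [List.length_take]; omega) (v.drop p) z
        (by rw [List.length_drop]; omega) hact hz3
      rw [this, hz2, ← Function.iterate_add_apply, hpp]
    · exact hzu (hN s v (by omega) z u (hz.trans hu1.symm) hz' hu3)
  · exact Or.inl ((hD _ hact).mono (by omega))

/-! ### Words over a power of the alphabet -/

/-- The words of length `M`, as letters of a new alphabet. -/
abbrev Power (X : Type) (M : ℕ) : Type := {l : List X // l.length = M}

instance [Finite X] (M : ℕ) : Finite (Power X M) := List.finite_length_eq X M

/-- The word over the original alphabet that is given by a word over a power of the alphabet. -/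
def flat {M : ℕ} (v : List (Power X M)) : List X := v.flatMap Subtype.val

theorem flat_cons {M : ℕ} (y : Power X M) (v : List (Power X M)) :
    flat (y :: v) = y.1 ++ flat v := List.flatMap_cons

theorem flat_injective {M : ℕ} (hM : 0 < M) : Function.Injective (flat (X := X) (M := M)) := by
  intro v
  induction v with
  | nil =>
    rintro (_ | ⟨y, w⟩) h
    · rfl
    · have := congrArg List.length h
      rw [flat_cons, List.length_append, y.2] at this
      simp only [flat, List.flatMap_nil, List.length_nil] at this
      omega
  | cons x v ih =>
    rintro (_ | ⟨y, w⟩) h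
    · have := congrArg List.length h
      rw [flat_cons, List.length_append, x.2] at this
      simp only [flat, List.flatMap_nil, List.length_nil] at this
      omega
    · rw [flat_cons, flat_cons] at h
      obtain ⟨h1, h2⟩ := List.append_inj h (x.2.trans y.2.symm)
      rw [Subtype.ext h1, ih h2]

theorem exists_flat_eq {M : ℕ} (k : ℕ) (u : List X) (hu : u.length = k * M) :
    ∃ v : List (Power X M), flat v = u := by
  induction k generalizing u with
  | zero =>
    rw [Nat.zero_mul, List.length_eq_zero_iff] at hu
    exact ⟨[], hu.symm⟩
  | succ k ih =>
    rw [Nat.succ_mul] at hu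
    obtain ⟨v, hv⟩ := ih (u.drop M) (by rw [List.length_drop]; omega)
    exact ⟨⟨u.take M, by rw [List.length_take]; omega⟩ :: v, by
      rw [flat_cons, hv, List.take_append_drop]⟩

variable (A) in
/-- The action of a state on the words of length `M`. -/
def levelPerm (M : ℕ) (s : S) : Equiv.Perm (Power X M) :=
  (A.perm s).subtypePerm fun l => by
    change (A.out s l).length = M ↔ _
    rw [length_out]

theorem exists_rooted {M : ℕ} {s : S} (h : A.IsTrivialBelow s M) (v : List (Power X M)) :
    A.out s (flat v) =
      flat ((DirectedAut.automaton (Power X M)).out (Sum.inr (A.levelPerm M s)) v) := by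
  rcases v with _ | ⟨y, v⟩
  · rfl
  · rw [DirectedAut.out_rooted_cons, flat_cons, flat_cons, out_append, (h _ y.2).out_eq]
    rfl

theorem exists_directed {M : ℕ} {s : S} (u : Power X M) (hu : A.stateSection s u = s)
    (h : ∀ z : Power X M, z ≠ u → A.IsTrivialBelow (A.stateSection s z) M)
    (v : List (Power X M)) :
    A.out s (flat v) = flat ((DirectedAut.automaton (Power X M)).out
      (Sum.inl ⟨u, A.levelPerm M s, fun z => A.levelPerm M (A.stateSection s z)⟩) v) := by
  induction v with
  | nil => rfl
  | cons y v ih =>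
    rw [flat_cons, out_append]
    by_cases hy : y = u
    · subst hy
      rw [hu, ih]
      refine Eq.trans ?_ (congrArg flat (DirectedAut.out_directed_pt
        ⟨y, A.levelPerm M s, fun z => A.levelPerm M (A.stateSection s z)⟩ v).symm)
      rw [flat_cons]
      rfl
    · rw [exists_rooted (h y hy), DirectedAut.out_directed_cons_of_ne
        (d := ⟨u, A.levelPerm M s, fun z => A.levelPerm M (A.stateSection s z)⟩) hy, flat_cons]
      rfl

/-! ### Representation of group elements by words of directed and rooted automorphisms -/

theorem perm_apply_inv {α : Type*} (e : Equiv.Perm α) (a : α) : e (e⁻¹ a) = a :=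
  e.apply_symm_apply a

/-- A permutation of the words that preserves the length and prefixes. -/
def IsTreeAut (π : Equiv.Perm (List X)) : Prop :=
  (∀ u, (π u).length = u.length) ∧ ∀ u v, π u <+: π (u ++ v)

/-- The permutation `π` acts on the words over a power of the alphabet like the permutation `o` of
the alphabet with the sections given by `s`. -/
def Represents {M : ℕ} (π : Equiv.Perm (List X)) (o : Equiv.Perm (Power X M))
    (s : Power X M → List (DirectedAut.Letter (Power X M))) : Prop :=
  IsTreeAut π ∧ ∀ y v, π (flat (y :: v)) =
    flat (o y :: (DirectedAut.automaton (Power X M)).wordPerm (s y) v)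

theorem IsTreeAut.mul {π π' : Equiv.Perm (List X)} (h : IsTreeAut π) (h' : IsTreeAut π') :
    IsTreeAut (π' * π) := by
  refine ⟨fun u => (h'.1 _).trans (h.1 _), fun u v => ?_⟩
  obtain ⟨w, hw⟩ := h.2 u v
  rw [Equiv.Perm.mul_apply, Equiv.Perm.mul_apply, ← hw]
  exact h'.2 _ _

theorem IsTreeAut.inv {π : Equiv.Perm (List X)} (h : IsTreeAut π) : IsTreeAut π⁻¹ := by
  have hlen : ∀ u, (π⁻¹ u).length = u.length := fun u => by
    rw [← h.1, perm_apply_inv]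
  refine ⟨hlen, fun u v => ?_⟩
  set w := π⁻¹ (u ++ v) with hw
  have hwlen : w.length = u.length + v.length := (hlen _).trans List.length_append
  have h1 := h.2 (w.take u.length) (w.drop u.length)
  rw [List.take_append_drop, hw, perm_apply_inv, ← hw] at h1
  have h2 : π (w.take u.length) = u := by
    refine (List.prefix_of_prefix_length_le h1 (List.prefix_append u v) ?_).eq_of_length ?_ <;>
    · rw [h.1, List.length_take]
      omega
  have h3 : π⁻¹ u = w.take u.length := Equiv.Perm.inv_eq_iff_eq.2 h2.symm
  rw [h3]
  exact List.take_prefix _ _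

variable {M : ℕ}

theorem Represents.one : Represents (X := X) (M := M) 1 1 fun _ => [] :=
  ⟨⟨fun _ => rfl, fun _ _ => List.prefix_append _ _⟩, fun _ _ => rfl⟩

theorem Represents.mul {π π' : Equiv.Perm (List X)} {o o' : Equiv.Perm (Power X M)}
    {s s' : Power X M → List (DirectedAut.Letter (Power X M))} (h : Represents π o s)
    (h' : Represents π' o' s') : Represents (π' * π) (o.trans o') fun y => s y ++ s' (o y) := by
  refine ⟨h.1.mul h'.1, fun y v => ?_⟩
  rw [Equiv.Perm.mul_apply, h.2, h'.2, wordPerm_append]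
  rfl

/-- The section of the inverse at `y` is the inverse of the section at `o⁻¹ y`, and words of
directed and rooted automorphisms are closed under inversion. -/
theorem Represents.exists_inv {π : Equiv.Perm (List X)} {o : Equiv.Perm (Power X M)}
    {s : Power X M → List (DirectedAut.Letter (Power X M))} (h : Represents π o s) :
    ∃ s', Represents π⁻¹ o⁻¹ s' := by
  have hmem : ∀ w, (DirectedAut.automaton (Power X M)).wordPerm w ∈
      (DirectedAut.automaton (Power X M)).group := fun w => by
    induction w with
    | nil => exact one_mem _
    | cons b w ih => exact mul_mem ih (Subgroup.subset_closure ⟨b, rfl⟩)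
  have hinv := fun y => DirectedAut.automaton_isClosedUnderInversion.exists_wordPerm_eq
    (inv_mem (hmem (s (o⁻¹ y))))
  choose s' hs' using hinv
  refine ⟨s', h.1.inv, fun y v => ?_⟩
  rw [Equiv.Perm.inv_eq_iff_eq, h.2, hs', perm_apply_inv, perm_apply_inv]

theorem Represents.eq_one_iff (hM : 0 < M) {π : Equiv.Perm (List X)} {o : Equiv.Perm (Power X M)}
    {s : Power X M → List (DirectedAut.Letter (Power X M))} (h : Represents π o s) :
    π = 1 ↔ o = 1 ∧ ∀ y, (DirectedAut.automaton (Power X M)).wordPerm (s y) = 1 := by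
  constructor
  · rintro rfl
    have h' : ∀ y v, o y = y ∧ (DirectedAut.automaton (Power X M)).wordPerm (s y) v = v :=
      fun y v => by
        have := flat_injective hM (h.2 y v)
        simpa [eq_comm] using this
    exact ⟨Equiv.ext fun y => (h' y []).1, fun y => Equiv.ext fun v => (h' y v).2⟩
  · rintro ⟨ho, hs⟩
    have hflat : ∀ v : List (Power X M), π (flat v) = flat v := fun v => by
      rcases v with _ | ⟨y, v⟩
      · exact List.length_eq_zero_iff.1 (h.1.1 _)
      · rw [h.2, ho, hs]
        rfl
    refine Equiv.ext fun u => ?_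
    rcases u with _ | ⟨x, u⟩
    · exact List.length_eq_zero_iff.1 (h.1.1 _)
    -- Only words whose length is a multiple of `M` are of the form `flat v`. Any other word is
    -- padded to such a length, and preservation of prefixes brings the result back.
    · set w := x :: u with hw
      obtain ⟨v, hv⟩ := exists_flat_eq (M := M) w.length
        (w ++ List.replicate (w.length * M - w.length) x) (by
          have := Nat.le_mul_of_pos_right w.length hM
          rw [List.length_append, List.length_replicate]
          omega)
      have h1 := h.1.2 w (List.replicate (w.length * M - w.length) x)
      rw [← hv, hflat, hv] at h1
      exact (List.prefix_of_prefix_length_le h1 (List.prefix_append _ _)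
        (h.1.1 w).le).eq_of_length (h.1.1 w)

theorem isTreeAut_perm (s : S) : IsTreeAut (A.perm s) :=
  ⟨A.length_out s, fun u v => ⟨_, (A.out_append s u v).symm⟩⟩

theorem IsBounded.exists_represents [Finite S] [Finite X] (hA : A.IsBounded) :
    ∃ M, 0 < M ∧ ∀ g ∈ A.group, ∃ (o : Equiv.Perm (Power X M))
      (s : Power X M → List (DirectedAut.Letter (Power X M))), Represents g o s := by
  obtain ⟨M, hM, hlevel⟩ := hA.exists_level
  refine ⟨M, hM, fun g hg => ?_⟩
  induction hg using Subgroup.closure_induction with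
  | mem g hg =>
    obtain ⟨s, rfl⟩ := hg
    -- Only the sections at level `M` are directed or rooted; the state itself need not be. This is
    -- why the transducer has input letters besides syllables.
    have hclass : ∀ y : Power X M, ∃ b : DirectedAut.Letter (Power X M), ∀ v,
        A.out (A.stateSection s y) (flat v) =
          flat ((DirectedAut.automaton (Power X M)).out b v) := fun y => by
      rcases hlevel s y.1 y.2 with h | ⟨u, hu1, hu2, hu3⟩
      · exact ⟨_, exists_rooted h⟩
      · exact ⟨_, exists_directed ⟨u, hu1⟩ hu2 fun z hz =>
          hu3 z.1 z.2 fun h => hz (Subtype.ext h)⟩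
    choose b hb using hclass
    refine ⟨A.levelPerm M s, fun y => [b y], isTreeAut_perm s, fun y v => ?_⟩
    rw [flat_cons, flat_cons]
    exact (A.out_append s _ _).trans (congrArg (_ ++ ·) (hb y v))
  | one => exact ⟨_, _, Represents.one⟩
  | mul g h _ _ hg hh =>
    obtain ⟨o, s, h1⟩ := hg
    obtain ⟨o', s', h2⟩ := hh
    exact ⟨_, _, h2.mul h1⟩
  | inv g _ hg =>
    obtain ⟨o, s, h1⟩ := hg
    obtain ⟨s', h2⟩ := h1.exists_inv
    exact ⟨_, _, h2⟩

theorem IsBounded.wordProblem_mem [Finite S] [Finite X] (hA : A.IsBounded) {G : Type*} [Group G]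
    (φ : G ≃* A.group) (T : Finset G) :
    InMultiTapeDTIME (wordProblem T) fun n => (n : ℝ) * Real.log n := by
  obtain ⟨M, hM, hrep⟩ := hA.exists_represents
  -- Inverses again, since products of represented permutations come in reversed order.
  have h1 := fun a : T => hrep _ (inv_mem (φ a).2)
  choose o s hos using h1
  let e : T ≃ Fin (Fintype.card T) := Fintype.equivFin T
  obtain ⟨N, C, D, E, hN⟩ := DirectedAut.exists_decidesInTime (fun i => o (e.symm i))
    (fun i => s (e.symm i)) e.toEmbedding
  refine ⟨N, _, ?_, isBigO_mul_clog C D E⟩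
  suffices h : wordProblem T = {w | DirectedAut.IsTrivialWord (fun i => o (e.symm i))
      (fun i => s (e.symm i)) (w.map fun a => Sum.inl (e.toEmbedding a))} by
    rw [h]
    exact hN
  ext w
  have hw : ∀ w : List T, Represents ((φ (w.map Subtype.val).prod : Equiv.Perm (List X))⁻¹)
      (DirectedAut.inputWordOut (fun i => o (e.symm i))
        (w.map fun a => Sum.inl (e.toEmbedding a)))
      (DirectedAut.inputWordSection (fun i => o (e.symm i)) (fun i => s (e.symm i))
        (w.map fun a => Sum.inl (e.toEmbedding a))) := fun w => by
    induction w with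
    | nil => simpa using! Represents.one
    | cons a w ih =>
      have := (hos a).mul ih
      rw [List.map_cons, List.prod_cons, map_mul, Subgroup.coe_mul, mul_inv_rev]
      simpa [DirectedAut.inputWordOut, DirectedAut.inputWordSection, DirectedAut.inputOut,
        DirectedAut.inputSection] using this
  change (w.map Subtype.val).prod = 1 ↔ _
  refine Iff.trans ?_ ((hw w).eq_one_iff hM)
  simp

end InvertibleAutomaton

theorem theorem3 :
    (∀ (G : Type*) [Group G], IsBoundedAutomatonGroup G →
      WordProblemInMultiTapeDTIME G fun n : ℕ => (n : ℝ) * Real.log (n : ℝ)) ∧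
    (∀ (G : Type*) [Group G], IsStronglyContractingAutomatonGroup G →
      WordProblemInMultiTapeDTIME G fun n : ℕ => (n : ℝ)) := by
  refine ⟨?_, ?_⟩
  · rintro G _ ⟨S, X, _, _, A, hA, ⟨φ⟩⟩
    have := A.group_fg
    exact ⟨Group.fg_of_surjective (f := φ.symm.toMonoidHom) φ.symm.surjective,
      fun T _ _ => hA.wordProblem_mem φ T⟩
  · rintro G _ ⟨S, X, _, _, A, hA, hA', ⟨φ⟩⟩
    have := A.group_fg
    exact ⟨Group.fg_of_surjective (f := φ.symm.toMonoidHom) φ.symm.surjective,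
      fun T _ _ => hA'.wordProblem_mem hA φ T⟩
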